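/- Let $I=[0,1]$. For a continuous map $f:I\to I$ and $m\ge 1$, a nondegenerate compact interval $L\subseteq I$ is called $f$-periodic of period $m$ if $f^m(L)=L$ and the sets $L,f(L),\dots,f^{m-1}(L)$ are pairwise disjoint. For an infinite $\omega$-limit set $\tilde\omega$ of $f$, a system associated with $\tilde\omega$ is a family $\{J(n,k): n\ge 0,\ 0\le k<2^n\}$ of compact intervals such that $f(J(n,k))=J(n,k+1)$ for $0\le k<2^n-1$, $J(n+1,0)\subseteq J(n,0)$, and each $J(n,k)$ is minimal with respect to inclusion among the $f$-periodic compact intervals of period $2^n$ whose orbit $L\cup f(L)\cup\dots\cup f^{2^n-1}(L)$ contains $\tilde\omega$. Its simple set is $M(\tilde\omega)=\bigcap_{n\ge 0}\bigcup_{0\le k<2^n}J(n,k)$. The map $f$ is Li–Yorke chaotic if there is an uncountable set $S\subseteq I$ such that $\limsup_{n\to\infty}|f^n(x)-f^n(y)|>0$ and $\liminf_{n\to\infty}|f^n(x)-f^n(y)|=0$ for all distinct $x,y\in S$. **Theorem 3.** There is a surjective continuous map $f:I\to I$ such that: (i) $f$ has exactly one infinite $\omega$-limit set $\tilde\omega$,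 and $f$ has zero topological entropy; (ii) $f$ is not Li–Yorke chaotic; (iii) a system associated with $\tilde\omega$ exists, its simple set $M(\tilde\omega)$ does not depend on the choice of the system, and $M(\tilde\omega)$ has nonempty interior; (iv) the nondegenerate connected components of $M(\tilde\omega)$ can be indexed, without repetition, as $\{G_n\}_{n\in\mathbb{Z}}$ so that $f(G_n)=G_{n+1}$ for all $n\in\mathbb{Z}$. -/

import Mathlib

open Set Filter Topology

namespace IntervalDynamics

/-- The `ω`-limit set of the point `x` under `f`: the limit points of the sequence `n ↦ fⁿ(x)`. -/
def omegaLimitSet {X : Type*} [TopologicalSpace X] (f : X → X) (x : X) : Set X :=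
  omegaLimit atTop (fun (n : ℕ) (y : X) => f^[n] y) {x}

/-- `S` is an infinite `ω`-limit set of `f`. -/
def IsInfiniteOmegaLimitSet {X : Type*} [TopologicalSpace X] (f : X → X) (S : Set X) : Prop :=
  S.Infinite ∧ ∃ x : X, S = omegaLimitSet f x

/-- Two distinct points form a Li–Yorke pair of `f`. -/
def IsLiYorkePair {X : Type*} [MetricSpace X] (f : X → X) (x y : X) : Prop :=
  x ≠ y ∧
    0 < limsup (fun n : ℕ => dist (f^[n] x) (f^[n] y)) atTop ∧
    liminf (fun n : ℕ => dist (f^[n] x) (f^[n] y)) atTop = 0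

/-- `f` has an uncountable Li–Yorke scrambled set. (Used on compact spaces, where the distances
above are bounded.) -/
def IsLiYorkeChaotic {X : Type*} [MetricSpace X] (f : X → X) : Prop :=
  ∃ S : Set X, ¬ S.Countable ∧ ∀ x ∈ S, ∀ y ∈ S, x ≠ y → IsLiYorkePair f x y

/-- `L` is a (nondegenerate) compact interval in `[0,1]` which is periodic of period `m` under `f`:
`f^m(L) = L`, and `L, f(L), …, f^{m-1}(L)` are pairwise disjoint. -/
structure IsPeriodicInterval (f : unitInterval → unitInterval) (m : ℕ) (L : Set unitInterval) :
    Prop where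
  nontrivial : L.Nontrivial
  isCompact : IsCompact L
  ordConnected : L.OrdConnected
  image_iterate : f^[m] '' L = L
  disjoint : ∀ i < m, ∀ j < m, i ≠ j → Disjoint (f^[i] '' L) (f^[j] '' L)

/-- `J n k`, for `n ≥ 0` and `0 ≤ k < 2^n`, is a system of periodic intervals associated with `W`:
the `J n k` (`0 ≤ k < 2^n`) form a cycle of `f`-periodic compact intervals of period `2^n` that
covers `W`, each of them is minimal (for inclusion) among the `f`-periodic compact intervals of
period `2^n` whose orbit covers `W`, and `J (n+1) 0 ⊆ J n 0`. Values with `k ≥ 2^n` are not used. -/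
structure IsAssociatedSystem (f : unitInterval → unitInterval) (W : Set unitInterval)
    (J : ℕ → ℕ → Set unitInterval) : Prop where
  minimal : ∀ n k, k < 2 ^ n →
    Minimal (fun L : Set unitInterval =>
      IsPeriodicInterval f (2 ^ n) L ∧ W ⊆ ⋃ i ∈ Finset.range (2 ^ n), f^[i] '' L) (J n k)
  image : ∀ n k, k + 1 < 2 ^ n → f '' J n k = J n (k + 1)
  nested : ∀ n, J (n + 1) 0 ⊆ J n 0

/-- The simple set of a system of intervals: `⋂ n, ⋃ k < 2^n, J n k`. -/
def simpleSet (J : ℕ → ℕ → Set unitInterval) : Set unitInterval :=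
  ⋂ n : ℕ, ⋃ k ∈ Finset.range (2 ^ n), J n k

/-- `M` is the simple set of some system associated with `W`. -/
def IsSimpleSet (f : unitInterval → unitInterval) (W M : Set unitInterval) : Prop :=
  ∃ J : ℕ → ℕ → Set unitInterval, IsAssociatedSystem f W J ∧ M = simpleSet J

/-- The connected components of `M` that have more than one point. -/
def nondegenerateComponents {X : Type*} [TopologicalSpace X] (M : Set X) : Set (Set X) :=
  {C | (∃ x ∈ M, C = connectedComponentIn M x) ∧ C.Nontrivial}

end IntervalDynamics

namespace BlownUpOdometer

open IntervalDynamics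

/-! The map is built so that `f ∘ lo = hi` and `f ∘ hi = lo ∘ f` (`f_lo`, `f_hi`), where `lo` and
`hi` embed `I` increasingly onto `[0, 7/16]` and `[9/16, 1]`. Hence `f²` on either half is conjugate
to `f`, and `f` is infinitely renormalizable, with a nested sequence of cycles of `2 ^ n` intervals
`block n k`. The twist is that `lo` is the identity on `[0, 1/4]` and `hi` on `[3/4, 1]`; elsewhere
they contract by 4 towards `1/4` and `3/4`. So these two end intervals survive in the intersection
of the cycles. As `f` maps `[3/4, 1]` onto `[0, 1/4]` by `x ↦ 1 - x`, they belong to a single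
two-sided orbit of wandering intervals.

An orbit that misses some cycle is trapped in a renormalized copy of the gap `[7/16, 9/16]`, where
`f` is affine of slope `-43/8`, so it is eventually periodic. Any other orbit ends up in the pieces
of the middle part `core`, whose diameters are at most `4⁻ⁿ / 2`, so up to a time shift it shadows
the orbit of `base = 1/4` to any precision. This dichotomy gives the unique infinite limit set and
excludes Li–Yorke pairs.

Every covering periodic interval of period `2 ^ n` contains a block (`IsCover.exists_block_subset`),
so the minimal ones are exactly the blocks and the simple set is `solenoid`. An interval inside it
is magnified by 4 under `lo⁻¹` or `hi⁻¹` until it meets `[0, 1/4)` or `(3/4, 1]`, which identifies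
the components. The entropy vanishes because renormalization halves time: orbit segments of length
`n` need at most a linear factor more classes than those of length `n / 2 + 1`
(`HasColoring.of_half`). -/

/-! ### Construction of the map by a self-similar series -/

/-- The restriction of the map to `[0, 9/16]`. -/
noncomputable def initialBranch (x : ℝ) : ℝ :=
  -- The inner `max` inverts `lo` and the outer one is `hi`, so the first argument of `min` is `hi ∘
  -- lo⁻¹`. The second is the affine piece over the gap, from 1 at `7/16` to `21/64 = lo (9/16)` at
  -- `9/16`, as required by `f (hi 0) = lo (f 0)`.
  min (max (max x (4 * x - 3 / 4)) (max x (4 * x - 3 / 4) / 4 + 9 / 16))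
    (1 - 43 / 8 * (x - 7 / 16))

/-- The generator of the self-similar function `selfSimilar`. -/
noncomputable def generator (u : ℝ) : ℝ :=
  initialBranch (max 0 (min (3 / 4 - u) (9 / 16))) - 21 / 64

/-- A solution of `F (u / 4) = F u / 4` for `u ≤ 3 / 4`. -/
noncomputable def selfSimilar (u : ℝ) : ℝ :=
  ∑' m : ℕ, (1 / 4 : ℝ) ^ m * generator (4 ^ m * u)

/-- The map, as a function of a real variable. -/
noncomputable def realMap (x : ℝ) : ℝ := 1 / 4 + selfSimilar (3 / 4 - x) + min (3 / 4 - x) 0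

lemma initialBranch_mem {x : ℝ} (h0 : 0 ≤ x) (h1 : x ≤ 9 / 16) :
    initialBranch x ∈ Icc (21 / 64 : ℝ) 1 := by
  unfold initialBranch
  constructor
  · refine le_min (le_max_of_le_right ?_) (by linarith)
    linarith [le_max_left x (4 * x - 3 / 4)]
  · rcases le_total x (7 / 16) with h | h
    · refine (min_le_left _ _).trans (max_le (max_le ?_ ?_) ?_) <;> try linarith
      have : max x (4 * x - 3 / 4) ≤ 1 := max_le (by linarith) (by linarith)
      linarith
    · exact (min_le_right _ _).trans (by linarith)

lemma generator_nonneg (u : ℝ) : 0 ≤ generator u := by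
  have := (initialBranch_mem (x := max 0 (min (3 / 4 - u) (9 / 16))) (le_max_left _ _)
    (max_le (by norm_num) (min_le_right _ _))).1
  unfold generator; linarith

lemma generator_le (u : ℝ) : generator u ≤ 43 / 64 := by
  have := (initialBranch_mem (x := max 0 (min (3 / 4 - u) (9 / 16))) (le_max_left _ _)
    (max_le (by norm_num) (min_le_right _ _))).2
  unfold generator; linarith

lemma initialBranch_zero : initialBranch 0 = 9 / 16 := by
  unfold initialBranch
  rw [max_eq_left (by norm_num : 4 * 0 - 3 / 4 ≤ (0 : ℝ)),
    max_eq_right (by norm_num), min_eq_left (by norm_num)]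
  norm_num

lemma initialBranch_gap {x : ℝ} (h0 : 7 / 16 ≤ x) :
    initialBranch x = 1 - 43 / 8 * (x - 7 / 16) := by
  unfold initialBranch
  refine min_eq_right (le_max_of_le_left (le_max_of_le_right ?_))
  linarith

lemma generator_of_le {u : ℝ} (h : u ≤ 3 / 16) : generator u = 0 := by
  unfold generator
  rw [min_eq_right (by linarith), max_eq_right (by norm_num), initialBranch_gap (by norm_num)]
  norm_num

lemma generator_of_ge {u : ℝ} (h : 3 / 4 ≤ u) : generator u = 15 / 64 := by
  unfold generator
  rw [max_eq_left ((min_le_left _ _).trans (by linarith)), initialBranch_zero]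
  norm_num

lemma continuous_generator : Continuous generator := by
  unfold generator initialBranch
  fun_prop

lemma summable_quarter : Summable (fun m : ℕ => (1 / 4 : ℝ) ^ m) :=
  summable_geometric_of_lt_one (by norm_num) (by norm_num)

lemma tsum_quarter : ∑' m : ℕ, (1 / 4 : ℝ) ^ m = 4 / 3 := by
  rw [tsum_geometric_of_lt_one (by norm_num) (by norm_num)]; norm_num

lemma selfSimilar_term_le (u : ℝ) (m : ℕ) :
    (1 / 4 : ℝ) ^ m * generator (4 ^ m * u) ≤ (1 / 4) ^ m * (43 / 64) :=
  mul_le_mul_of_nonneg_left (generator_le _) (by positivity)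

lemma selfSimilar_term_nonneg (u : ℝ) (m : ℕ) :
    0 ≤ (1 / 4 : ℝ) ^ m * generator (4 ^ m * u) :=
  mul_nonneg (by positivity) (generator_nonneg _)

lemma summable_selfSimilar (u : ℝ) :
    Summable (fun m : ℕ => (1 / 4 : ℝ) ^ m * generator (4 ^ m * u)) :=
  Summable.of_nonneg_of_le (selfSimilar_term_nonneg u) (selfSimilar_term_le u)
    (summable_quarter.mul_right _)

lemma continuous_selfSimilar : Continuous selfSimilar := by
  unfold selfSimilar
  refine continuous_tsum (fun m => ?_) (summable_quarter.mul_right (43 / 64)) (fun m u => ?_)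
  · exact continuous_const.mul (continuous_generator.comp (continuous_const.mul continuous_id))
  · rw [Real.norm_of_nonneg (selfSimilar_term_nonneg u m)]
    exact selfSimilar_term_le u m

/-- For `u ≤ 3/16` the generator vanishes, leaving the scaling law. For `u ≥ 3/16` the last term is
the constant `5/64`, so that the generator prescribes the function freely there. -/
lemma selfSimilar_eq (u : ℝ) : selfSimilar u = generator u + selfSimilar (4 * u) / 4 := by
  unfold selfSimilar
  rw [(summable_selfSimilar u).tsum_eq_zero_add]
  simp only [pow_zero, one_mul, div_eq_mul_inv, ← tsum_mul_right]
  congr 1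
  refine tsum_congr fun m => ?_
  rw [pow_succ (4 : ℝ) m, mul_assoc, pow_succ]
  ring

lemma selfSimilar_nonneg (u : ℝ) : 0 ≤ selfSimilar u := tsum_nonneg (selfSimilar_term_nonneg u)

lemma selfSimilar_of_ge {u : ℝ} (h : 3 / 4 ≤ u) : selfSimilar u = 5 / 16 := by
  have : ∀ m : ℕ, generator (4 ^ m * u) = 15 / 64 := fun m => generator_of_ge <| by
    nlinarith [one_le_pow₀ (by norm_num : (1 : ℝ) ≤ 4) (n := m)]
  simp only [selfSimilar, this, tsum_mul_right, tsum_quarter]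
  norm_num

lemma selfSimilar_of_nonpos {u : ℝ} (h : u ≤ 0) : selfSimilar u = 0 := by
  have : ∀ m : ℕ, generator (4 ^ m * u) = 0 := fun m => generator_of_le <| by
    nlinarith [one_le_pow₀ (by norm_num : (1 : ℝ) ≤ 4) (n := m)]
  simp [selfSimilar, this]

lemma selfSimilar_le (u : ℝ) : selfSimilar u ≤ 3 / 4 := by
  have h1 : ∀ v, selfSimilar v ≤ 1 := fun v => by
    have := (summable_selfSimilar v).tsum_le_tsum (selfSimilar_term_le v)
      (summable_quarter.mul_right (43 / 64))
    rw [tsum_mul_right, tsum_quarter] at this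
    exact this.trans (by norm_num)
  rw [selfSimilar_eq]
  rcases le_total u (3 / 16) with h | h
  · rw [generator_of_le h]; linarith [h1 (4 * u)]
  · rw [selfSimilar_of_ge (by linarith)]; linarith [generator_le u]

lemma realMap_of_le {x : ℝ} (h0 : 0 ≤ x) (h1 : x ≤ 9 / 16) : realMap x = initialBranch x := by
  rw [realMap, selfSimilar_eq, selfSimilar_of_ge (by linarith), min_eq_right (by linarith),
    generator, sub_sub_cancel, min_eq_left h1, max_eq_right h0]
  ring

lemma realMap_of_ge {x : ℝ} (h : 3 / 4 ≤ x) : realMap x = 1 - x := by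
  rw [realMap, selfSimilar_of_nonpos (by linarith), min_eq_left (by linarith)]
  ring

lemma realMap_mem {x : ℝ} (h : x ∈ Icc (0 : ℝ) 1) : realMap x ∈ Icc (0 : ℝ) 1 := by
  have h1 := selfSimilar_nonneg (3 / 4 - x)
  have h2 := selfSimilar_le (3 / 4 - x)
  unfold realMap
  constructor
  · rcases min_choice (3 / 4 - x) 0 with h' | h' <;> rw [h'] <;> linarith [h.2]
  · linarith [min_le_right (3 / 4 - x) 0]

lemma continuous_realMap : Continuous realMap := by
  unfold realMap
  have := continuous_selfSimilar
  fun_prop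

/-- The interval map with wandering intervals. -/
noncomputable def f : C(unitInterval, unitInterval) where
  toFun x := ⟨realMap x, realMap_mem x.2⟩
  continuous_toFun := by
    have := continuous_realMap
    fun_prop

/-! ### The two embeddings and the renormalization equations -/

/-- The contraction onto the lower half of the first renormalization. -/
noncomputable def lo (x : unitInterval) : unitInterval :=
  ⟨min x (x / 4 + 3 / 16), le_min x.2.1 (by linarith [x.2.1]), min_le_of_left_le x.2.2⟩

/-- The contraction onto the upper half of the first renormalization. -/
noncomputable def hi (x : unitInterval) : unitInterval :=
  ⟨max x (x / 4 + 9 / 16), le_max_of_le_left x.2.1, max_le x.2.2 (by linarith [x.2.2])⟩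

lemma coe_f (x : unitInterval) : (f x : ℝ) = realMap x := rfl

lemma coe_lo (x : unitInterval) : (lo x : ℝ) = min (x : ℝ) (x / 4 + 3 / 16) := rfl

lemma coe_hi (x : unitInterval) : (hi x : ℝ) = max (x : ℝ) (x / 4 + 9 / 16) := rfl

lemma coe_lo_of_ge {x : unitInterval} (h : 1 / 4 ≤ (x : ℝ)) : (lo x : ℝ) = x / 4 + 3 / 16 := by
  rw [coe_lo, min_eq_right (by linarith)]

lemma lo_of_le {x : unitInterval} (h : (x : ℝ) ≤ 1 / 4) : lo x = x := by
  ext; rw [coe_lo, min_eq_left (by linarith)]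

lemma coe_hi_of_le {x : unitInterval} (h : (x : ℝ) ≤ 3 / 4) : (hi x : ℝ) = x / 4 + 9 / 16 := by
  rw [coe_hi, max_eq_right (by linarith)]

lemma hi_of_ge {x : unitInterval} (h : 3 / 4 ≤ (x : ℝ)) : hi x = x := by
  ext; rw [coe_hi, max_eq_left (by linarith)]

lemma coe_lo_le (x : unitInterval) : (lo x : ℝ) ≤ 7 / 16 := by
  rw [coe_lo]; exact (min_le_right _ _).trans (by linarith [x.2.2])

lemma le_coe_hi (x : unitInterval) : 9 / 16 ≤ (hi x : ℝ) := by
  rw [coe_hi]; exact le_max_of_le_right (by linarith [x.2.1])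

lemma f_lo (x : unitInterval) : f (lo x) = hi x := by
  ext
  have h1 : max (lo x : ℝ) (4 * (lo x : ℝ) - 3 / 4) = x := by
    rcases le_total (x : ℝ) (1 / 4) with h | h
    · rw [lo_of_le h, max_eq_left (by linarith)]
    · rw [coe_lo_of_ge h, max_eq_right (by linarith)]; ring
  rw [coe_f, realMap_of_le (lo x).2.1 (by linarith [coe_lo_le x]), initialBranch, h1, coe_hi,
    min_eq_left]
  have h2 := (hi x).2.2
  rw [coe_hi] at h2
  linarith [coe_lo_le x]

/-- Below `3/4`, `hi` divides the distance to `3/4` by 4 and `lo` divides the height above `1/4` by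
4, so this is the scaling law of `selfSimilar`. Above `3/4` both embeddings act as the identity. -/
lemma f_hi (x : unitInterval) : f (hi x) = lo (f x) := by
  ext
  rcases le_total (x : ℝ) (3 / 4) with h | h
  · have h1 : (f x : ℝ) = 1 / 4 + selfSimilar (3 / 4 - x) := by
      rw [coe_f, realMap, min_eq_right (by linarith), add_zero]
    rw [coe_lo_of_ge (by rw [h1]; linarith [selfSimilar_nonneg (3 / 4 - x)]), coe_f,
      coe_hi_of_le h, h1, realMap, min_eq_right (by linarith), selfSimilar_eq,
      generator_of_le (by linarith [x.2.1])]
    ring_nf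
  · rw [hi_of_ge h, lo_of_le]
    rw [coe_f, realMap_of_ge h]; linarith

lemma coe_f_gap {x : unitInterval} (h0 : 7 / 16 ≤ (x : ℝ)) (h1 : (x : ℝ) ≤ 9 / 16) :
    (f x : ℝ) = 1 - 43 / 8 * (x - 7 / 16) := by
  rw [coe_f, realMap_of_le x.2.1 h1, initialBranch_gap h0]

lemma coe_f_of_ge {x : unitInterval} (h : 3 / 4 ≤ (x : ℝ)) : (f x : ℝ) = 1 - x := by
  rw [coe_f, realMap_of_ge h]

lemma continuous_lo : Continuous lo := by unfold lo; fun_prop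

lemma strictMono_lo : StrictMono lo := by
  intro x y (h : (x : ℝ) < y)
  change (lo x : ℝ) < lo y
  rw [coe_lo, coe_lo]
  exact min_lt_min h (by linarith)

lemma strictMono_hi : StrictMono hi := by
  intro x y (h : (x : ℝ) < y)
  change (hi x : ℝ) < hi y
  rw [coe_hi, coe_hi]
  exact max_lt_max h (by linarith)

lemma dist_eq_abs (x y : unitInterval) : dist x y = |(x : ℝ) - y| := rfl

lemma dist_lo_le (x y : unitInterval) : dist (lo x) (lo y) ≤ dist x y := by
  rw [dist_eq_abs, dist_eq_abs, coe_lo, coe_lo]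
  refine (abs_min_sub_min_le_max _ _ _ _).trans (max_le le_rfl ?_)
  rw [show (x : ℝ) / 4 + 3 / 16 - (y / 4 + 3 / 16) = (x - y) / 4 by ring, abs_div]
  norm_num
  linarith [abs_nonneg ((x : ℝ) - y)]

lemma dist_hi_le (x y : unitInterval) : dist (hi x) (hi y) ≤ dist x y := by
  rw [dist_eq_abs, dist_eq_abs, coe_hi, coe_hi]
  refine (abs_max_sub_max_le_max _ _ _ _).trans (max_le le_rfl ?_)
  rw [show (x : ℝ) / 4 + 9 / 16 - (y / 4 + 9 / 16) = (x - y) / 4 by ring, abs_div]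
  norm_num
  linarith [abs_nonneg ((x : ℝ) - y)]

lemma dist_le_lo (x y : unitInterval) : dist x y / 4 ≤ dist (lo x) (lo y) := by
  wlog h : y ≤ x generalizing x y
  · rw [dist_comm x, dist_comm (lo x)]; exact this y x (le_of_not_ge h)
  have h' : (y : ℝ) ≤ x := h
  rw [dist_eq_abs, dist_eq_abs, abs_of_nonneg (by linarith)]
  refine le_trans ?_ (le_abs_self _)
  rcases le_total (x : ℝ) (1 / 4) with hx | hx <;> rcases le_total (y : ℝ) (1 / 4) with hy | hy
  · rw [lo_of_le hx, lo_of_le hy]; linarith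
  · rw [lo_of_le hx, coe_lo_of_ge hy]; linarith
  · rw [coe_lo_of_ge hx, lo_of_le hy]; linarith
  · rw [coe_lo_of_ge hx, coe_lo_of_ge hy]; linarith

lemma dist_le_hi (x y : unitInterval) : dist x y / 4 ≤ dist (hi x) (hi y) := by
  wlog h : y ≤ x generalizing x y
  · rw [dist_comm x, dist_comm (hi x)]; exact this y x (le_of_not_ge h)
  have h' : (y : ℝ) ≤ x := h
  rw [dist_eq_abs, dist_eq_abs, abs_of_nonneg (by linarith)]
  refine le_trans ?_ (le_abs_self _)
  rcases le_total (x : ℝ) (3 / 4) with hx | hx <;> rcases le_total (y : ℝ) (3 / 4) with hy | hy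
  · rw [coe_hi_of_le hx, coe_hi_of_le hy]; linarith
  · rw [coe_hi_of_le hx, hi_of_ge hy]; linarith
  · rw [hi_of_ge hx, coe_hi_of_le hy]; linarith
  · rw [hi_of_ge hx, hi_of_ge hy]; linarith

lemma mem_range_lo {x : unitInterval} : x ∈ range lo ↔ (x : ℝ) ≤ 7 / 16 := by
  refine ⟨by rintro ⟨y, rfl⟩; exact coe_lo_le y, fun h => ?_⟩
  rcases le_total (x : ℝ) (1 / 4) with h' | h'
  · exact ⟨x, lo_of_le h'⟩
  · refine ⟨⟨4 * x - 3 / 4, by linarith, by linarith⟩, ?_⟩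
    ext
    rw [coe_lo_of_ge (by change 1 / 4 ≤ 4 * (x : ℝ) - 3 / 4; linarith)]
    change (4 * (x : ℝ) - 3 / 4) / 4 + 3 / 16 = x
    ring

lemma mem_range_hi {x : unitInterval} : x ∈ range hi ↔ 9 / 16 ≤ (x : ℝ) := by
  refine ⟨by rintro ⟨y, rfl⟩; exact le_coe_hi y, fun h => ?_⟩
  rcases le_total (x : ℝ) (3 / 4) with h' | h'
  · refine ⟨⟨4 * x - 9 / 4, by linarith, by linarith⟩, ?_⟩
    ext
    rw [coe_hi_of_le (by change 4 * (x : ℝ) - 9 / 4 ≤ 3 / 4; linarith)]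
    change (4 * (x : ℝ) - 9 / 4) / 4 + 9 / 16 = x
    ring
  · exact ⟨x, hi_of_ge h'⟩

lemma surjective_f : Function.Surjective f := by
  intro y
  have h1 : (f 1 : ℝ) = 0 := by rw [coe_f_of_ge] <;> norm_num
  have h2 : (f (lo 1) : ℝ) = 1 := by rw [f_lo, hi_of_ge (by norm_num)]; rfl
  have := isPreconnected_univ.intermediate_value (mem_univ (1 : unitInterval))
    (mem_univ (lo 1)) f.continuous.continuousOn
  obtain ⟨x, -, hx⟩ := this ⟨show (f 1 : ℝ) ≤ y by rw [h1]; exact y.2.1,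
    show (y : ℝ) ≤ f (lo 1) by rw [h2]; exact y.2.2⟩
  exact ⟨x, hx⟩

lemma f_f_lo (x : unitInterval) : f (f (lo x)) = lo (f x) := by rw [f_lo, f_hi]

lemma f_f_hi (x : unitInterval) : f (f (hi x)) = hi (f x) := by rw [f_hi, f_lo]

lemma f_iterate_lo (k : ℕ) (x : unitInterval) : f^[2 * k] (lo x) = lo (f^[k] x) := by
  induction k with
  | zero => rfl
  | succ k ih =>
    rw [mul_add, mul_one, add_comm, Function.iterate_add_apply, ih, Function.iterate_succ_apply' _ k]
    exact f_f_lo _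

lemma f_iterate_hi (k : ℕ) (x : unitInterval) : f^[2 * k] (hi x) = hi (f^[k] x) := by
  induction k with
  | zero => rfl
  | succ k ih =>
    rw [mul_add, mul_one, add_comm, Function.iterate_add_apply, ih, Function.iterate_succ_apply' _ k]
    exact f_f_hi _

lemma f_iterate_succ_lo (k : ℕ) (x : unitInterval) : f^[2 * k + 1] (lo x) = hi (f^[k] x) := by
  rw [Function.iterate_succ_apply', f_iterate_lo, f_lo]

lemma f_iterate_succ_hi (k : ℕ) (x : unitInterval) :
    f^[2 * k + 1] (hi x) = lo (f^[k + 1] x) := by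
  rw [Function.iterate_succ_apply', f_iterate_hi, f_hi, Function.iterate_succ_apply']

lemma f_iterate_two_pow (n : ℕ) (x : unitInterval) : f^[2 ^ n] (lo^[n] x) = lo^[n] (f x) := by
  induction n with
  | zero => rfl
  | succ n ih =>
    rw [Function.iterate_succ_apply', Function.iterate_succ_apply', pow_succ', f_iterate_lo, ih]

lemma f_iterate_two_pow_mul (n q : ℕ) (x : unitInterval) :
    f^[2 ^ n * q] (lo^[n] x) = lo^[n] (f^[q] x) := by
  induction q with
  | zero => rfl
  | succ q ih =>
    rw [mul_add, mul_one, add_comm, Function.iterate_add_apply, ih, f_iterate_two_pow,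
      Function.iterate_succ_apply']

/-! ### Cycles of blocks and their geometry -/

/-- The `k`-th image of the `n`-th renormalized copy of `A`. -/
def piece (A : Set unitInterval) (n k : ℕ) : Set unitInterval := f^[k] '' (lo^[n] '' A)

/-- The periodic intervals of period `2 ^ n`. -/
abbrev block : ℕ → ℕ → Set unitInterval := piece univ

/-- The part of the interval outside `[0, 1/4)` and `(3/4, 1]`. -/
def core : Set unitInterval := {x | 1 / 4 ≤ (x : ℝ) ∧ (x : ℝ) ≤ 3 / 4}

lemma piece_mono {A B : Set unitInterval} (h : A ⊆ B) (n k : ℕ) : piece A n k ⊆ piece B n k :=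
  image_mono (image_mono h)

lemma piece_zero (A : Set unitInterval) : piece A 0 0 = A := by simp [piece]

lemma piece_succ_even (A : Set unitInterval) (n k : ℕ) :
    piece A (n + 1) (2 * k) = lo '' piece A n k := by
  simp only [piece, image_image]
  exact image_congr fun x _ => by rw [Function.iterate_succ_apply', f_iterate_lo]

lemma piece_succ_odd (A : Set unitInterval) (n k : ℕ) :
    piece A (n + 1) (2 * k + 1) = hi '' piece A n k := by
  simp only [piece, image_image]
  exact image_congr fun x _ => by rw [Function.iterate_succ_apply' _ n, f_iterate_succ_lo]

lemma image_iterate_piece (A : Set unitInterval) (n k i : ℕ) :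
    f^[i] '' piece A n k = piece A n (i + k) := by
  simp only [piece, image_image, Function.iterate_add_apply]

lemma image_piece (A : Set unitInterval) (n k : ℕ) : f '' piece A n k = piece A n (k + 1) := by
  rw [add_comm]; exact image_iterate_piece A n k 1

lemma block_add_two_pow (n k : ℕ) : block n (k + 2 ^ n) = block n k := by
  unfold block piece
  rw [image_image, image_image]
  ext y
  constructor
  · rintro ⟨x, -, rfl⟩
    exact ⟨f x, mem_univ _, by beta_reduce; rw [Function.iterate_add_apply, f_iterate_two_pow]⟩
  · rintro ⟨x, -, rfl⟩
    obtain ⟨z, rfl⟩ := surjective_f x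
    exact ⟨z, mem_univ _, by beta_reduce; rw [Function.iterate_add_apply, f_iterate_two_pow]⟩

lemma block_mod (n k : ℕ) : block n (k % 2 ^ n) = block n k := by
  have : Function.Periodic (block n) (2 ^ n) := fun k => block_add_two_pow n k
  exact this.map_mod_nat k

/-- At the lowest binary digit where `k` and `l` differ, the points lie on opposite sides of the gap
of length `1/8`; each common digit before it shrinks distances by at most 4. -/
lemma le_dist_of_mem_block {n k l : ℕ} {x y : unitInterval} (hx : x ∈ block n k)
    (hy : y ∈ block n l) (h : ¬ k ≡ l [MOD 2 ^ n]) : (1 / 4 : ℝ) ^ n / 8 ≤ dist x y := by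
  induction n generalizing k l x y with
  | zero => exact absurd (by simpa using Nat.modEq_one) h
  | succ n ih =>
    have key : (1 / 4 : ℝ) ^ (n + 1) / 8 ≤ 1 / 8 := by
      have := pow_le_one₀ (n := n + 1) (by norm_num : (0 : ℝ) ≤ 1 / 4) (by norm_num)
      linarith
    have far : ∀ a b, (1 / 8 : ℝ) ≤ dist (lo a) (hi b) := fun a b => by
      rw [dist_comm, dist_eq_abs]
      exact le_trans (by linarith [coe_lo_le a, le_coe_hi b]) (le_abs_self _)
    have step : (1 / 4 : ℝ) ^ (n + 1) / 8 = (1 / 4) ^ n / 8 / 4 := by ring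
    rcases Nat.even_or_odd' k with ⟨k, rfl | rfl⟩ <;> rcases Nat.even_or_odd' l with ⟨l, rfl | rfl⟩
    · rw [block, piece_succ_even] at hx hy
      obtain ⟨a, ha, rfl⟩ := hx
      obtain ⟨b, hb, rfl⟩ := hy
      have := ih ha hb fun h' => h (by rw [pow_succ']; exact h'.mul_left' 2)
      linarith [dist_le_lo a b]
    · rw [block, piece_succ_even] at hx
      rw [block, piece_succ_odd] at hy
      obtain ⟨a, ha, rfl⟩ := hx
      obtain ⟨b, hb, rfl⟩ := hy
      exact key.trans (far _ _)
    · rw [block, piece_succ_odd] at hx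
      rw [block, piece_succ_even] at hy
      obtain ⟨a, ha, rfl⟩ := hx
      obtain ⟨b, hb, rfl⟩ := hy
      rw [dist_comm]
      exact key.trans (far _ _)
    · rw [block, piece_succ_odd] at hx hy
      obtain ⟨a, ha, rfl⟩ := hx
      obtain ⟨b, hb, rfl⟩ := hy
      have := ih ha hb fun h' => h (by rw [pow_succ']; exact (h'.mul_left' 2).add_right 1)
      linarith [dist_le_hi a b]

lemma disjoint_block {n k l : ℕ} (h : ¬ k ≡ l [MOD 2 ^ n]) : Disjoint (block n k) (block n l) := by
  rw [disjoint_left]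
  intro x hx hy
  have := le_dist_of_mem_block hx hy h
  rw [dist_self] at this
  have : (0 : ℝ) < (1 / 4) ^ n / 8 := by positivity
  linarith

lemma mapsTo_lo_core : MapsTo lo core core := fun x ⟨h1, h2⟩ => by
  rw [core, mem_ofPred_eq, coe_lo_of_ge h1]
  constructor <;> linarith

lemma mapsTo_hi_core : MapsTo hi core core := fun x ⟨h1, h2⟩ => by
  rw [core, mem_ofPred_eq, coe_hi_of_le h2]
  constructor <;> linarith

lemma piece_core_subset {n k : ℕ} (hk : k < 2 ^ n) : piece core n k ⊆ core := by
  induction n generalizing k with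
  | zero => obtain rfl : k = 0 := by simpa using hk
            rw [piece_zero]
  | succ n ih =>
    rcases Nat.even_or_odd' k with ⟨k, rfl | rfl⟩
    · rw [piece_succ_even]
      exact (mapsTo_lo_core.mono_left (ih (by rw [pow_succ'] at hk; omega))).image_subset
    · rw [piece_succ_odd]
      exact (mapsTo_hi_core.mono_left (ih (by rw [pow_succ'] at hk; omega))).image_subset

lemma dist_lo_of_mem_core {x y : unitInterval} (hx : x ∈ core) (hy : y ∈ core) :
    dist (lo x) (lo y) = dist x y / 4 := by
  rw [dist_eq_abs, dist_eq_abs, coe_lo_of_ge hx.1, coe_lo_of_ge hy.1,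
    show (x : ℝ) / 4 + 3 / 16 - (y / 4 + 3 / 16) = (x - y) / 4 by ring, abs_div]
  norm_num

lemma dist_hi_of_mem_core {x y : unitInterval} (hx : x ∈ core) (hy : y ∈ core) :
    dist (hi x) (hi y) = dist x y / 4 := by
  rw [dist_eq_abs, dist_eq_abs, coe_hi_of_le hx.2, coe_hi_of_le hy.2,
    show (x : ℝ) / 4 + 9 / 16 - (y / 4 + 9 / 16) = (x - y) / 4 by ring, abs_div]
  norm_num

/-- On `core`, an interval of length `1/2` preserved by `lo` and `hi`, both maps contract by exactly
4. -/
lemma dist_le_of_mem_piece_core {n k : ℕ} (hk : k < 2 ^ n) {x y : unitInterval}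
    (hx : x ∈ piece core n k) (hy : y ∈ piece core n k) : dist x y ≤ (1 / 4) ^ n / 2 := by
  induction n generalizing k x y with
  | zero =>
    have hx' := piece_core_subset hk hx
    have hy' := piece_core_subset hk hy
    rw [dist_eq_abs, abs_le]
    constructor <;> norm_num <;> linarith [hx'.1, hx'.2, hy'.1, hy'.2]
  | succ n ih =>
    have step : (1 / 4 : ℝ) ^ (n + 1) / 2 = (1 / 4) ^ n / 2 / 4 := by ring
    rcases Nat.even_or_odd' k with ⟨k, rfl | rfl⟩
    · have hk' : k < 2 ^ n := by rw [pow_succ'] at hk; omega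
      rw [piece_succ_even] at hx hy
      obtain ⟨a, ha, rfl⟩ := hx
      obtain ⟨b, hb, rfl⟩ := hy
      rw [dist_lo_of_mem_core (piece_core_subset hk' ha) (piece_core_subset hk' hb)]
      linarith [ih hk' ha hb]
    · have hk' : k < 2 ^ n := by rw [pow_succ'] at hk; omega
      rw [piece_succ_odd] at hx hy
      obtain ⟨a, ha, rfl⟩ := hx
      obtain ⟨b, hb, rfl⟩ := hy
      rw [dist_hi_of_mem_core (piece_core_subset hk' ha) (piece_core_subset hk' hb)]
      linarith [ih hk' ha hb]

/-! ### Orbits entering all cycles, and orbits trapped in a gap -/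

/-- The right end point of the leftmost wandering interval. -/
noncomputable def base : unitInterval := ⟨1 / 4, by norm_num, by norm_num⟩

lemma coe_base : (base : ℝ) = 1 / 4 := rfl

lemma lo_base : lo base = base := lo_of_le le_rfl

lemma lo_iterate_base (n : ℕ) : lo^[n] base = base := Function.iterate_fixed lo_base n

/-- Since `lo` fixes `x`, the point at time `2k` or `2k + 1` is `lo` or `hi` of the point at time
`k`, so time can be halved down to `f x = hi x`. -/
lemma iterate_mem_core_of_le {x : unitInterval} (hx : (x : ℝ) ≤ 1 / 4) {q : ℕ} (hq : 0 < q) :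
    f^[q] x ∈ core := by
  induction q using Nat.strong_induction_on with
  | _ q ih =>
    rw [← lo_of_le hx]
    rcases Nat.even_or_odd' q with ⟨k, rfl | rfl⟩
    · rw [f_iterate_lo]
      exact mapsTo_lo_core (ih k (by omega) (by omega))
    · rw [f_iterate_succ_lo]
      rcases k.eq_zero_or_pos with rfl | hk
      · rw [Function.iterate_zero_apply, core, mem_ofPred_eq, coe_hi_of_le (by linarith)]
        constructor <;> linarith [x.2.1]
      · exact mapsTo_hi_core (ih k (by omega) hk)

lemma eventually_mem_core (x : unitInterval) : ∃ Q, ∀ q ≥ Q, f^[q] x ∈ core := by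
  by_cases h : ∀ q, f^[q] x ∈ core
  · exact ⟨0, fun q _ => h q⟩
  push Not at h
  obtain ⟨q, hq⟩ := h
  obtain ⟨r, hr⟩ : ∃ r, (f^[r] x : ℝ) ≤ 1 / 4 := by
    rcases le_total (f^[q] x : ℝ) (1 / 4) with h | h
    · exact ⟨q, h⟩
    · have h' : 3 / 4 ≤ (f^[q] x : ℝ) := by
        by_contra h'
        exact hq ⟨h, (not_le.1 h').le⟩
      exact ⟨q + 1, by rw [Function.iterate_succ_apply', coe_f_of_ge h']; linarith⟩
  refine ⟨r + 1, fun t ht => ?_⟩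
  obtain ⟨s, rfl⟩ := Nat.exists_eq_add_of_le ht
  rw [show r + 1 + s = (s + 1) + r by ring, Function.iterate_add_apply]
  exact iterate_mem_core_of_le hr (Nat.succ_pos s)

lemma iterate_base_mem_core (q : ℕ) : f^[q] base ∈ core := by
  rcases q.eq_zero_or_pos with rfl | hq
  · exact ⟨le_rfl, by rw [Function.iterate_zero_apply, coe_base]; norm_num⟩
  · exact iterate_mem_core_of_le le_rfl hq

lemma iterate_base_mem_piece (n t : ℕ) : f^[t] base ∈ piece core n (t % 2 ^ n) := by
  refine ⟨_, ⟨f^[t / 2 ^ n] base, iterate_base_mem_core _, rfl⟩, ?_⟩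
  rw [← f_iterate_two_pow_mul, ← Function.iterate_add_apply, Nat.mod_add_div, lo_iterate_base]

/-- The orbit of `x` enters all cycles of blocks. -/
def IsDeep (x : unitInterval) : Prop := ∀ n, ∃ t, f^[t] x ∈ range lo^[n]

lemma IsDeep.eventually_mem_piece {x : unitInterval} (hx : IsDeep x) (n : ℕ) :
    ∃ T s, ∀ t ≥ T, f^[t] x ∈ piece core n ((t + s) % 2 ^ n) := by
  obtain ⟨τ, y, hy⟩ := hx n
  obtain ⟨Q, hQ⟩ := eventually_mem_core y
  -- The shift `(2 ^ n - 1) * τ` represents `-τ` modulo `2 ^ n` in the naturals; the delay `2 ^ n *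
  -- Q` lets the renormalized orbit settle in `core`.
  refine ⟨τ + 2 ^ n * Q, (2 ^ n - 1) * τ, fun t ht => ?_⟩
  obtain ⟨r, rfl⟩ := Nat.exists_eq_add_of_le ht
  have h1 : (τ + 2 ^ n * Q + r + (2 ^ n - 1) * τ) % 2 ^ n = r % 2 ^ n := by
    obtain ⟨p, hp⟩ : ∃ p, 2 ^ n = p + 1 := ⟨2 ^ n - 1, by have := Nat.two_pow_pos n; omega⟩
    rw [hp, Nat.add_sub_cancel, show τ + (p + 1) * Q + r + p * τ = r + (p + 1) * (τ + Q) by ring,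
      Nat.add_mul_mod_self_left]
  rw [h1]
  refine ⟨_, ⟨f^[Q + r / 2 ^ n] y, hQ _ (Nat.le_add_right _ _), rfl⟩, ?_⟩
  have h2 : τ + 2 ^ n * Q + r = r % 2 ^ n + (2 ^ n * (Q + r / 2 ^ n) + τ) := by
    nth_rewrite 1 [← Nat.mod_add_div r (2 ^ n)]
    ring
  rw [h2, Function.iterate_add_apply _ _ (_ + _), Function.iterate_add_apply _ _ τ, ← hy,
    f_iterate_two_pow_mul]

lemma exists_quarter_pow_lt {ε : ℝ} (hε : 0 < ε) : ∃ n : ℕ, (1 / 4 : ℝ) ^ n < ε :=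
  exists_pow_lt_of_lt_one hε (by norm_num)

lemma iterate_gap_dist {x y : unitInterval} {s : ℕ}
    (hx : ∀ t < s, (f^[t] x : ℝ) ∈ Icc (7 / 16 : ℝ) (9 / 16))
    (hy : ∀ t < s, (f^[t] y : ℝ) ∈ Icc (7 / 16 : ℝ) (9 / 16)) :
    ∀ t ≤ s, dist (f^[t] x) (f^[t] y) = (43 / 8) ^ t * dist x y := by
  intro t ht
  induction t with
  | zero => simp
  | succ t ih =>
    have h1 := hx t ht
    have h2 := hy t ht
    rw [pow_succ', mul_assoc, ← ih (by omega), Function.iterate_succ_apply',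
      Function.iterate_succ_apply', dist_eq_abs, dist_eq_abs, coe_f_gap h1.1 h1.2,
      coe_f_gap h2.1 h2.2, show ∀ a b : ℝ, 1 - 43 / 8 * (a - 7 / 16) - (1 - 43 / 8 * (b - 7 / 16))
        = -(43 / 8 * (a - b)) by intros; ring, abs_neg, abs_mul]
    norm_num

/-- Otherwise the orbits of `x` and `f x` would separate by a factor `43/8` at each step, although
distances are at most 1. -/
lemma fixed_of_iterate_mem_gap {x : unitInterval}
    (hx : ∀ t, (f^[t] x : ℝ) ∈ Icc (7 / 16 : ℝ) (9 / 16)) : f x = x := by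
  by_contra h
  have h0 : 0 < dist (f x) x := dist_pos.2 h
  obtain ⟨t, ht⟩ := pow_unbounded_of_one_lt (1 / dist (f x) x) (by norm_num : (1 : ℝ) < 43 / 8)
  have h1 := iterate_gap_dist (x := f x) (y := x) (s := t)
    (fun t _ => by rw [← Function.iterate_succ_apply]; exact hx _) (fun t _ => hx t) t le_rfl
  rw [div_lt_iff₀ h0, ← h1, dist_eq_abs] at ht
  have h2 := abs_le.2 (⟨by linarith [(f^[t] (f x)).2.1, (f^[t] x).2.2],
    by linarith [(f^[t] (f x)).2.2, (f^[t] x).2.1]⟩ :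
      -1 ≤ (f^[t] (f x) : ℝ) - f^[t] x ∧ (f^[t] (f x) : ℝ) - f^[t] x ≤ 1)
  linarith

/-- A point whose orbit misses some cycle of blocks is eventually periodic. -/
lemma eventually_periodic_of_not_isDeep {x : unitInterval} (hx : ¬ IsDeep x) :
    ∃ t m, 0 < m ∧ f^[m] (f^[t] x) = f^[t] x := by
  classical
  unfold IsDeep at hx
  push Not at hx
  obtain ⟨m, hm⟩ : ∃ m, Nat.find hx = m + 1 := Nat.exists_eq_succ_of_ne_zero fun h => by
    have := Nat.find_spec hx 0
    rw [h] at this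
    simp at this
  have hbad := Nat.find_spec hx
  rw [hm] at hbad
  have hgood := Nat.find_min hx (m := m) (by omega)
  push Not at hgood
  obtain ⟨t, y, hy⟩ := hgood
  have hlo : ∀ s, f^[s] y ∉ range lo := by
    rintro s ⟨z, hz⟩
    refine hbad (2 ^ m * s + t) ⟨z, ?_⟩
    rw [Function.iterate_add_apply (⇑f), ← hy, f_iterate_two_pow_mul, ← hz, Function.iterate_succ_apply _ m]
  -- A visit to the range of `hi` is followed by one to the range of `lo`, so both halves are
  -- avoided.
  have hgap : ∀ s, (f^[s] y : ℝ) ∈ Icc (7 / 16 : ℝ) (9 / 16) := by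
    refine fun s => ⟨not_lt.1 fun h => hlo s (mem_range_lo.2 h.le), not_lt.1 fun h => ?_⟩
    obtain ⟨z, hz⟩ := mem_range_hi.2 h.le
    exact hlo (s + 1) ⟨f z, by rw [Function.iterate_succ_apply', ← hz, f_hi]⟩
  refine ⟨t, 2 ^ m, by positivity, ?_⟩
  rw [← hy, f_iterate_two_pow, fixed_of_iterate_mem_gap hgap]

/-! ### The unique infinite limit set -/

lemma mem_omegaLimitSet_iff {X : Type*} [PseudoMetricSpace X] {g : X → X} {x y : X} :
    y ∈ omegaLimitSet g x ↔ ∀ ε > 0, ∀ N, ∃ t ≥ N, dist (g^[t] x) y < ε := by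
  rw [omegaLimitSet, mem_omegaLimit_singleton_iff_mapClusterPt,
    Metric.nhds_basis_ball.mapClusterPt_iff_frequently]
  simp only [frequently_atTop, Metric.mem_ball]

lemma finite_orbit {X : Type*} {g : X → X} {x : X} {t m : ℕ} (hm : 0 < m)
    (h : g^[m] (g^[t] x) = g^[t] x) : (range fun n => g^[n] x).Finite := by
  refine ((finite_Iio (t + m)).image fun n => g^[n] x).subset ?_
  rintro _ ⟨n, rfl⟩
  rcases lt_or_ge n (t + m) with hn | hn
  · exact ⟨n, hn, rfl⟩
  · refine ⟨(n - t) % m + t, ?_, ?_⟩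
    · have := Nat.mod_lt (n - t) hm
      simp only [mem_Iio]; omega
    · beta_reduce
      rw [Function.iterate_add_apply, (show Function.IsPeriodicPt g m (g^[t] x) from
        h).iterate_mod_apply, ← Function.iterate_add_apply]
      congr 2; omega

lemma finite_orbit_of_not_isDeep {x : unitInterval} (hx : ¬ IsDeep x) :
    (range fun n => f^[n] x).Finite := by
  obtain ⟨t, m, hm, h⟩ := eventually_periodic_of_not_isDeep hx
  exact finite_orbit hm h

/-- The infinite limit set. -/
def limitSet : Set unitInterval := omegaLimitSet f base

lemma IsDeep.exists_shadow {x : unitInterval} (hx : IsDeep x) (n : ℕ) :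
    ∃ T s, ∀ t ≥ T, dist (f^[t] x) (f^[t + s] base) ≤ (1 / 4) ^ n / 2 := by
  obtain ⟨T, s, h⟩ := hx.eventually_mem_piece n
  exact ⟨T, s, fun t ht => dist_le_of_mem_piece_core (Nat.mod_lt _ (by positivity)) (h t ht)
    (iterate_base_mem_piece n (t + s))⟩

lemma IsDeep.omegaLimitSet_eq {x : unitInterval} (hx : IsDeep x) :
    omegaLimitSet f x = limitSet := by
  ext p
  rw [limitSet, mem_omegaLimitSet_iff, mem_omegaLimitSet_iff]
  constructor
  · intro h ε hε N
    obtain ⟨n, hn⟩ := exists_quarter_pow_lt hε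
    obtain ⟨T, s, hs⟩ := hx.exists_shadow n
    obtain ⟨t, ht, htp⟩ := h (ε / 2) (half_pos hε) (max N T)
    refine ⟨t + s, by have := le_max_left N T; omega, ?_⟩
    have := hs t ((le_max_right _ _).trans ht)
    rw [dist_comm] at this
    linarith [dist_triangle (f^[t + s] base) (f^[t] x) p]
  · intro h ε hε N
    obtain ⟨n, hn⟩ := exists_quarter_pow_lt hε
    obtain ⟨T, s, hs⟩ := hx.exists_shadow n
    obtain ⟨t, ht, htp⟩ := h (ε / 2) (half_pos hε) (max N T + s)
    obtain ⟨r, rfl⟩ := Nat.exists_eq_add_of_le ht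
    have := hs (max N T + r) (by have := le_max_right N T; omega)
    refine ⟨max N T + r, by have := le_max_left N T; omega, ?_⟩
    rw [show max N T + r + s = max N T + s + r by ring] at this
    linarith [dist_triangle (f^[max N T + r] x) (f^[max N T + s + r] base) p]

lemma coe_lo_iterate {x : unitInterval} (hx : 1 / 4 ≤ (x : ℝ)) (n : ℕ) :
    (lo^[n] x : ℝ) = 1 / 4 + (1 / 4) ^ n * (x - 1 / 4) := by
  induction n with
  | zero => simp
  | succ n ih =>
    have : 0 ≤ (1 / 4 : ℝ) ^ n * (x - 1 / 4) := mul_nonneg (by positivity) (by linarith)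
    rw [Function.iterate_succ_apply', coe_lo_of_ge (by linarith), ih]
    ring

lemma coe_f_base : (f base : ℝ) = 5 / 8 := by
  rw [← lo_base, f_lo, coe_hi_of_le (by rw [coe_base]; norm_num), coe_base]
  norm_num

lemma coe_iterate_two_pow_base (n : ℕ) :
    (f^[2 ^ n] base : ℝ) = 1 / 4 + (1 / 4) ^ n * (3 / 8) := by
  conv_lhs => rw [← lo_iterate_base n]
  rw [f_iterate_two_pow, coe_lo_iterate (by rw [coe_f_base]; norm_num), coe_f_base]
  norm_num

lemma base_mem_limitSet : base ∈ limitSet := by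
  rw [limitSet, mem_omegaLimitSet_iff]
  intro ε hε N
  obtain ⟨n, hn⟩ := exists_quarter_pow_lt hε
  refine ⟨2 ^ max n N, (Nat.lt_two_pow_self.le.trans' (le_max_right n N)), ?_⟩
  have h1 : (1 / 4 : ℝ) ^ max n N ≤ (1 / 4) ^ n :=
    pow_le_pow_of_le_one (by norm_num) (by norm_num) (le_max_left _ _)
  have h2 : (0 : ℝ) < (1 / 4) ^ max n N := by positivity
  rw [dist_eq_abs, coe_iterate_two_pow_base, coe_base, abs_of_nonneg (by linarith)]
  linarith

lemma iterate_mem_limitSet {x : unitInterval} (hx : x ∈ limitSet) (m : ℕ) :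
    f^[m] x ∈ limitSet := by
  rw [limitSet, omegaLimitSet, mem_omegaLimit_singleton_iff_mapClusterPt] at *
  have h1 := hx.continuousAt_comp (f.continuous.iterate m).continuousAt
  rw [MapClusterPt] at *
  refine h1.mono ?_
  have : (f^[m] ∘ fun t => f^[t] base) = (fun t => f^[t] base) ∘ fun t => m + t := by
    ext t; simp [Function.iterate_add_apply]
  rw [this, ← map_map]
  exact map_mono (tendsto_atTop_mono (fun t => Nat.le_add_left t m) tendsto_id)

lemma infinite_limitSet : limitSet.Infinite := by
  refine infinite_of_injective_forall_mem (f := fun n : ℕ => f^[2 ^ n] base) ?_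
    fun n => iterate_mem_limitSet base_mem_limitSet _
  intro m n h
  have h' := congrArg (Subtype.val) h
  beta_reduce at h'
  rw [coe_iterate_two_pow_base, coe_iterate_two_pow_base] at h'
  exact pow_right_injective₀ (by norm_num : (0 : ℝ) < 1 / 4) (by norm_num)
    (by simpa using h')

lemma omegaLimitSet_subset_of_isClosed {x : unitInterval} {C : Set unitInterval}
    (hC : IsClosed C) (h : ∀ t, f^[t] x ∈ C) : omegaLimitSet f x ⊆ C := by
  intro y hy
  rw [omegaLimitSet, mem_omegaLimit_singleton_iff_mapClusterPt] at hy
  exact hC.closure_subset (mem_closure_iff_clusterPt.2 (hy.clusterPt.mono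
    (le_principal_iff.2 (Eventually.of_forall (f := atTop) h))))

lemma isInfiniteOmegaLimitSet_iff (S : Set unitInterval) :
    IsInfiniteOmegaLimitSet f S ↔ S = limitSet := by
  constructor
  · rintro ⟨hinf, x, rfl⟩
    by_cases hx : IsDeep x
    · exact hx.omegaLimitSet_eq
    · have hfin := finite_orbit_of_not_isDeep hx
      exact absurd (hfin.subset (omegaLimitSet_subset_of_isClosed hfin.isClosed
        fun t => mem_range_self t)) hinf
  · rintro rfl
    exact ⟨infinite_limitSet, base, rfl⟩

/-! ### Absence of Li–Yorke pairs -/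

lemma isLiYorkePair_frequently {x y : unitInterval} (h : IsLiYorkePair f x y) {δ : ℝ}
    (hδ : 0 < δ) (N : ℕ) : ∃ t ≥ N, dist (f^[t] x) (f^[t] y) < δ := by
  by_contra! hcon
  have h1 : δ ≤ liminf (fun n : ℕ => dist (f^[n] x) (f^[n] y)) atTop := by
    refine le_liminf_of_le ?_ (eventually_atTop.2 ⟨N, hcon⟩)
    exact (isBoundedUnder_of ⟨Metric.diam univ, fun n =>
      Metric.dist_le_diam_of_mem (isCompact_univ (X := unitInterval)).isBounded
        (mem_univ _) (mem_univ _)⟩).isCoboundedUnder_ge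
  rw [h.2.2] at h1
  exact h1.not_gt hδ

lemma isLiYorkePair_not_tendsto {x y : unitInterval} (h : IsLiYorkePair f x y) :
    ¬ Tendsto (fun n : ℕ => dist (f^[n] x) (f^[n] y)) atTop (𝓝 0) := fun h' => by
  have := h.2.1
  rw [h'.limsup_eq] at this
  exact this.false

lemma isLiYorkePair_symm {x y : unitInterval} (h : IsLiYorkePair f x y) :
    IsLiYorkePair f y x := by
  obtain ⟨h1, h2, h3⟩ := h
  refine ⟨h1.symm, ?_, ?_⟩
  · simpa only [dist_comm] using h2
  · simpa only [dist_comm] using h3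

lemma isCompact_piece {A : Set unitInterval} (hA : IsCompact A) (n k : ℕ) :
    IsCompact (piece A n k) :=
  (hA.image (continuous_lo.iterate n)).image (f.continuous.iterate k)

/-- Two deep orbits with equal phases at level `n` are eventually within `4⁻ⁿ / 2`; with different
phases they stay at least `4⁻ⁿ / 8` apart. So they are either asymptotic or eventually separated. -/
lemma not_isLiYorkePair_of_isDeep {x y : unitInterval} (hx : IsDeep x) (hy : IsDeep y) :
    ¬ IsLiYorkePair f x y := fun h => by
  refine isLiYorkePair_not_tendsto h (Metric.tendsto_atTop.2 fun ε hε => ?_)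
  obtain ⟨n, hn⟩ := exists_quarter_pow_lt hε
  obtain ⟨T, s, hs⟩ := hx.eventually_mem_piece n
  obtain ⟨T', s', hs'⟩ := hy.eventually_mem_piece n
  have hpos : (0 : ℝ) < (1 / 4) ^ n := by positivity
  by_cases hss : s ≡ s' [MOD 2 ^ n]
  · refine ⟨max T T', fun t ht => ?_⟩
    have h1 := hs t ((le_max_left _ _).trans ht)
    have h2 := hs' t ((le_max_right _ _).trans ht)
    rw [show (t + s) % 2 ^ n = (t + s') % 2 ^ n from hss.add_left t] at h1
    have := dist_le_of_mem_piece_core (Nat.mod_lt _ (by positivity)) h1 h2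
    rw [Real.dist_0_eq_abs, abs_of_nonneg dist_nonneg]
    linarith
  · exfalso
    obtain ⟨t, ht, hlt⟩ := isLiYorkePair_frequently h
      (by positivity : (0 : ℝ) < (1 / 4) ^ n / 8) (max T T')
    have h1 := piece_mono (subset_univ _) _ _ (hs t ((le_max_left _ _).trans ht))
    have h2 := piece_mono (subset_univ _) _ _ (hs' t ((le_max_right _ _).trans ht))
    refine hlt.not_ge (le_dist_of_mem_block h1 h2 fun h3 => hss ?_)
    have h4 : t + s ≡ t + s' [MOD 2 ^ n] := by simpa [Nat.ModEq] using h3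
    exact Nat.ModEq.add_left_cancel' t h4

lemma not_isLiYorkePair_of_not_isDeep_of_isDeep {x y : unitInterval} (hx : ¬ IsDeep x)
    (hy : IsDeep y) : ¬ IsLiYorkePair f x y := fun h => by
  have hfin := finite_orbit_of_not_isDeep hx
  unfold IsDeep at hx
  push Not at hx
  obtain ⟨n, hn⟩ := hx
  obtain ⟨T, s, hs⟩ := hy.eventually_mem_piece n
  have hclosed : IsClosed (⋃ k ∈ Finset.range (2 ^ n), block n k) :=
    isClosed_biUnion_finset fun k _ => (isCompact_piece isCompact_univ n k).isClosed
  have hdisj : Disjoint (range fun t => f^[t] x) (⋃ k ∈ Finset.range (2 ^ n), block n k) := by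
    rw [disjoint_left]
    rintro _ ⟨t, rfl⟩ h'
    simp only [mem_iUnion, Finset.mem_range] at h'
    obtain ⟨k, hk, _, ⟨z, -, rfl⟩, hz⟩ := h'
    -- Completing the cycle from phase `k` would bring the orbit into the range of `lo^[n]`.
    refine hn (2 ^ n - k + t) ⟨f z, ?_⟩
    rw [Function.iterate_add_apply (⇑f), ← hz, ← Function.iterate_add_apply,
      Nat.sub_add_cancel hk.le, f_iterate_two_pow]
  obtain ⟨r, hr, hr'⟩ := Metric.exists_pos_forall_lt_edist hfin.isCompact hclosed hdisj
  obtain ⟨t, ht, hlt⟩ := isLiYorkePair_frequently h (NNReal.coe_pos.2 hr) T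
  have h1 := hr' _ (mem_range_self t) (f^[t] y) (by
    simp only [mem_iUnion, Finset.mem_range]
    exact ⟨_, Nat.mod_lt _ (by positivity), piece_mono (subset_univ _) _ _ (hs t ht)⟩)
  rw [edist_nndist] at h1
  have h2 : (r : ℝ) < dist (f^[t] x) (f^[t] y) := by
    rw [← coe_nndist]; exact_mod_cast h1
  exact lt_asymm hlt h2

/-- Both orbits are finite, so only finitely many distances occur; coming close enough forces the
orbits to merge. -/
lemma not_isLiYorkePair_of_not_isDeep {x y : unitInterval} (hx : ¬ IsDeep x)
    (hy : ¬ IsDeep y) : ¬ IsLiYorkePair f x y := fun h => by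
  have hfin : ((fun p : unitInterval × unitInterval => dist p.1 p.2) ''
      ((range fun n => f^[n] x) ×ˢ (range fun n => f^[n] y)) \ {0}).Finite :=
    (((finite_orbit_of_not_isDeep hx).prod (finite_orbit_of_not_isDeep hy)).image _).sdiff
  obtain ⟨δ, hδ, hball⟩ := Metric.mem_nhds_iff.1
    (hfin.isClosed.isOpen_compl.mem_nhds (x := 0) (by simp))
  obtain ⟨t, -, hlt⟩ := isLiYorkePair_frequently h hδ 0
  have h1 : f^[t] x = f^[t] y := by
    by_contra hne
    refine hball (a := dist (f^[t] x) (f^[t] y)) (by simpa [abs_of_nonneg] using hlt)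
      ⟨⟨(_, _), ⟨mem_range_self t, mem_range_self t⟩, rfl⟩, by simpa using hne⟩
  refine isLiYorkePair_not_tendsto h (tendsto_const_nhds.congr' (eventually_atTop.2 ⟨t, fun s hs => ?_⟩))
  obtain ⟨r, rfl⟩ := Nat.exists_eq_add_of_le' hs
  beta_reduce
  rw [Function.iterate_add_apply, Function.iterate_add_apply, h1, dist_self]

lemma not_isLiYorkePair (x y : unitInterval) : ¬ IsLiYorkePair f x y := fun h => by
  by_cases hx : IsDeep x <;> by_cases hy : IsDeep y
  · exact not_isLiYorkePair_of_isDeep hx hy h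
  · exact not_isLiYorkePair_of_not_isDeep_of_isDeep hy hx (isLiYorkePair_symm h)
  · exact not_isLiYorkePair_of_not_isDeep_of_isDeep hx hy h
  · exact not_isLiYorkePair_of_not_isDeep hx hy h

lemma not_isLiYorkeChaotic : ¬ IsLiYorkeChaotic f := by
  rintro ⟨S, hS, h⟩
  refine hS (Set.Subsingleton.countable fun x hx y hy => ?_)
  by_contra hne
  exact not_isLiYorkePair x y (h x hx y hy hne)

/-! ### Minimality of the blocks -/

/-- The point `lo 1 = 7/16` lies between `base = 1/4` and `f base = 5/8`, and its orbit continues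
with `1` and then `0`. -/
lemma eq_univ_of_mapsTo {A : Set unitInterval} (hA : A.OrdConnected) (hb : base ∈ A)
    (hf : MapsTo f A A) : A = univ := by
  have h1 : lo 1 ∈ A := by
    refine hA.out hb (hf hb) ⟨?_, ?_⟩
    · exact Subtype.coe_le_coe.1 (by rw [coe_base, coe_lo_of_ge] <;> norm_num)
    · refine Subtype.coe_le_coe.1 ?_
      rw [coe_f_base, coe_lo_of_ge] <;> norm_num
  have h2 : (1 : unitInterval) ∈ A := by
    have := hf h1
    rwa [f_lo, hi_of_ge (by norm_num)] at this
  have h3 : (0 : unitInterval) ∈ A := by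
    have := hf h2
    rwa [show f 1 = 0 by ext; rw [coe_f_of_ge] <;> norm_num] at this
  exact eq_univ_of_forall fun x => hA.out h3 h2 ⟨x.2.1, x.2.2⟩

lemma injective_lo_iterate (n : ℕ) : Function.Injective lo^[n] :=
  strictMono_lo.injective.iterate n

lemma nontrivial_block (n k : ℕ) : (block n k).Nontrivial := by
  -- After `(2 ^ n - 1) * k` further steps the phase is `2 ^ n * k`, congruent to 0, where the block
  -- is an injective image of `I`.
  refine Set.nontrivial_of_image f^[(2 ^ n - 1) * k] _ ?_
  have h : (2 ^ n - 1) * k + k = 2 ^ n * k := by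
    obtain ⟨p, hp⟩ : ∃ p, 2 ^ n = p + 1 := ⟨2 ^ n - 1, by have := Nat.two_pow_pos n; omega⟩
    rw [hp, Nat.add_sub_cancel]; ring
  rw [image_iterate_piece, h, ← block, ← block_mod, Nat.mul_mod_right, block, piece,
    Function.iterate_zero, image_id]
  exact nontrivial_univ.image (injective_lo_iterate n)

lemma isPeriodicInterval_block (n k : ℕ) : IsPeriodicInterval f (2 ^ n) (block n k) where
  nontrivial := nontrivial_block n k
  isCompact := isCompact_piece isCompact_univ n k
  ordConnected := ((isPreconnected_univ.image _ (continuous_lo.iterate n).continuousOn).image _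
    (f.continuous.iterate k).continuousOn).ordConnected
  image_iterate := by rw [image_iterate_piece, add_comm]; exact block_add_two_pow n k
  disjoint i hi j hj hij := by
    rw [image_iterate_piece, image_iterate_piece]
    exact disjoint_block fun h => hij (Nat.ModEq.eq_of_lt_of_lt (h.add_right_cancel' k) hi hj)

/-- The union of the blocks of level `n`. -/
def level (n : ℕ) : Set unitInterval := ⋃ k, block n k

lemma mem_level {n : ℕ} {x : unitInterval} : x ∈ level n ↔ ∃ k, x ∈ block n k := mem_iUnion

lemma biUnion_block (n k : ℕ) : ⋃ i ∈ Finset.range (2 ^ n), block n (i + k) = level n := by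
  ext x
  simp only [mem_iUnion, mem_level, Finset.mem_range, exists_prop]
  constructor
  · rintro ⟨i, -, h⟩
    exact ⟨_, h⟩
  · rintro ⟨i, h⟩
    refine ⟨(i + (2 ^ n - 1) * k) % 2 ^ n, Nat.mod_lt _ (by positivity), ?_⟩
    have h1 : i + (2 ^ n - 1) * k + k = i + 2 ^ n * k := by
      obtain ⟨p, hp⟩ : ∃ p, 2 ^ n = p + 1 := ⟨2 ^ n - 1, by have := Nat.two_pow_pos n; omega⟩
      rw [hp, Nat.add_sub_cancel]; ring
    rwa [← block_mod, Nat.mod_add_mod, h1, Nat.add_mul_mod_self_left, block_mod]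

lemma isClosed_level (n : ℕ) : IsClosed (level n) := by
  rw [← biUnion_block n 0]
  exact isClosed_biUnion_finset fun k _ => (isCompact_piece isCompact_univ n _).isClosed

lemma limitSet_subset_level (n : ℕ) : limitSet ⊆ level n :=
  omegaLimitSet_subset_of_isClosed (isClosed_level n) fun t =>
    mem_level.2 ⟨_, piece_mono (subset_univ _) _ _ (iterate_base_mem_piece n t)⟩

/-- The property with respect to which the intervals of an associated system are minimal. -/
abbrev IsCover (n : ℕ) (L : Set unitInterval) : Prop :=
  IsPeriodicInterval f (2 ^ n) L ∧ limitSet ⊆ ⋃ i ∈ Finset.range (2 ^ n), f^[i] '' L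

lemma isCover_block (n k : ℕ) : IsCover n (block n k) := by
  refine ⟨isPeriodicInterval_block n k, ?_⟩
  simp only [image_iterate_piece]
  rw [biUnion_block]
  exact limitSet_subset_level n

/-- Some image of `L` contains `base`, which `lo^[n]` fixes. Its preimage under `lo^[n]` is an
invariant interval containing `base`, hence all of `I`. -/
lemma IsCover.exists_block_subset {n : ℕ} {L : Set unitInterval} (h : IsCover n L) :
    ∃ i, block n i ⊆ L := by
  obtain ⟨hL, hW⟩ := h
  have hb := hW base_mem_limitSet
  simp only [mem_iUnion, Finset.mem_range] at hb
  obtain ⟨i, hi, hb⟩ := hb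
  have hord : (f^[i] '' L).OrdConnected :=
    (hL.ordConnected.isPreconnected.image _ (f.continuous.iterate i).continuousOn).ordConnected
  have hA : lo^[n] ⁻¹' (f^[i] '' L) = univ := by
    refine eq_univ_of_mapsTo (hord.preimage_mono (strictMono_lo.monotone.iterate n)) ?_ ?_
    · rwa [mem_preimage, lo_iterate_base]
    · intro x hx
      obtain ⟨z, hz, hzx⟩ := hx
      rw [mem_preimage, ← f_iterate_two_pow, ← hzx, ← Function.iterate_add_apply, add_comm,
        Function.iterate_add_apply]
      exact mem_image_of_mem _ (hL.image_iterate.subset (mem_image_of_mem _ hz))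
  -- The remaining `2 ^ n - i` steps carry `f^[i] '' L` back to `L`.
  refine ⟨2 ^ n - i, ?_⟩
  rw [← hL.image_iterate, show f^[2 ^ n] '' L = f^[2 ^ n - i] '' (f^[i] '' L) by
    rw [image_image]; simp only [← Function.iterate_add_apply, Nat.sub_add_cancel hi.le]]
  exact image_mono (image_subset_iff.2 hA.ge)

lemma block_eq_of_subset {n i k : ℕ} (h : block n i ⊆ block n k) : block n i = block n k := by
  have : i ≡ k [MOD 2 ^ n] := by
    by_contra hik
    obtain ⟨x, hx⟩ := (nontrivial_block n i).nonempty
    exact disjoint_left.1 (disjoint_block hik) hx (h hx)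
  rw [← block_mod n i, ← block_mod n k, this]

lemma minimal_block (n k : ℕ) : Minimal (IsCover n) (block n k) := by
  refine ⟨isCover_block n k, fun L hL hle => ?_⟩
  obtain ⟨i, hi⟩ := hL.exists_block_subset
  rwa [← block_eq_of_subset (hi.trans hle)]

lemma exists_eq_block_of_minimal {n : ℕ} {L : Set unitInterval} (h : Minimal (IsCover n) L) :
    ∃ i, L = block n i := by
  obtain ⟨i, hi⟩ := h.prop.exists_block_subset
  exact ⟨i, (h.eq_of_le (isCover_block n i) hi).symm⟩

lemma isAssociatedSystem_block : IsAssociatedSystem f limitSet block where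
  minimal n k _ := minimal_block n k
  image n k _ := image_piece univ n k
  nested n := by
    simp only [block, piece, Function.iterate_zero, image_id, Function.iterate_succ, image_comp]
    exact image_mono (subset_univ _)

/-! ### The simple set and its gaps -/

/-- The simple set of the infinite limit set. -/
def solenoid : Set unitInterval := ⋂ n, level n

lemma IsAssociatedSystem.simpleSet_eq {J : ℕ → ℕ → Set unitInterval}
    (h : IsAssociatedSystem f limitSet J) : simpleSet J = solenoid := by
  refine iInter_congr fun n => ?_
  obtain ⟨i, hi⟩ := exists_eq_block_of_minimal (h.minimal n 0 (by positivity))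
  have hJ : ∀ k < 2 ^ n, J n k = block n (k + i) := fun k hk => by
    induction k with
    | zero => rw [hi, zero_add]
    | succ k ih =>
      rw [← h.image n k hk, ih (by omega), image_piece, add_right_comm]
  rw [← biUnion_block n i]
  exact iUnion₂_congr fun k hk => hJ k (Finset.mem_range.1 hk)

lemma isSimpleSet_iff (M : Set unitInterval) : IsSimpleSet f limitSet M ↔ M = solenoid := by
  constructor
  · rintro ⟨J, hJ, rfl⟩
    exact IsAssociatedSystem.simpleSet_eq hJ
  · rintro rfl
    exact ⟨block, isAssociatedSystem_block,
      (IsAssociatedSystem.simpleSet_eq isAssociatedSystem_block).symm⟩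

lemma level_zero : level 0 = univ :=
  eq_univ_of_forall fun _ => mem_level.2 ⟨0, by rw [block, piece_zero]; trivial⟩

lemma level_succ (n : ℕ) : level (n + 1) = lo '' level n ∪ hi '' level n := by
  ext x
  simp only [level, image_iUnion, mem_union, mem_iUnion]
  constructor
  · rintro ⟨k, hk⟩
    rcases Nat.even_or_odd' k with ⟨k, rfl | rfl⟩
    · exact Or.inl ⟨k, by rwa [← piece_succ_even]⟩
    · exact Or.inr ⟨k, by rwa [← piece_succ_odd]⟩
  · rintro (⟨k, hk⟩ | ⟨k, hk⟩)
    · exact ⟨2 * k, by rwa [block, piece_succ_even]⟩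
    · exact ⟨2 * k + 1, by rwa [block, piece_succ_odd]⟩

lemma lo_ne_hi (x y : unitInterval) : lo x ≠ hi y := fun h => by
  have := le_coe_hi y
  rw [← h] at this
  linarith [coe_lo_le x]

lemma lo_mem_solenoid {x : unitInterval} : lo x ∈ solenoid ↔ x ∈ solenoid := by
  simp only [solenoid, mem_iInter]
  constructor
  · intro h n
    have := h (n + 1)
    rw [level_succ] at this
    rcases this with ⟨y, hy, hyx⟩ | ⟨y, hy, hyx⟩
    · rwa [← strictMono_lo.injective hyx]
    · exact absurd hyx.symm (lo_ne_hi _ _)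
  · rintro h (_ | n)
    · rw [level_zero]; trivial
    · rw [level_succ]; exact Or.inl ⟨x, h n, rfl⟩

lemma hi_mem_solenoid {x : unitInterval} : hi x ∈ solenoid ↔ x ∈ solenoid := by
  simp only [solenoid, mem_iInter]
  constructor
  · intro h n
    have := h (n + 1)
    rw [level_succ] at this
    rcases this with ⟨y, hy, hyx⟩ | ⟨y, hy, hyx⟩
    · exact absurd hyx (lo_ne_hi _ _)
    · rwa [← strictMono_hi.injective hyx]
  · rintro h (_ | n)
    · rw [level_zero]; trivial
    · rw [level_succ]; exact Or.inr ⟨x, h n, rfl⟩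

lemma mem_range_of_mem_solenoid {x : unitInterval} (hx : x ∈ solenoid) :
    x ∈ range lo ∨ x ∈ range hi := by
  have := mem_iInter.1 hx 1
  rw [level_succ] at this
  exact this.imp (image_subset_range _ _ ·) (image_subset_range _ _ ·)

lemma mem_solenoid_of_le {x : unitInterval} (hx : (x : ℝ) ≤ 1 / 4) : x ∈ solenoid := by
  refine mem_iInter.2 fun n => ?_
  induction n with
  | zero => rw [level_zero]; trivial
  | succ n ih => rw [level_succ]; exact Or.inl ⟨x, ih, lo_of_le hx⟩

lemma mem_solenoid_of_ge {x : unitInterval} (hx : 3 / 4 ≤ (x : ℝ)) : x ∈ solenoid := by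
  refine mem_iInter.2 fun n => ?_
  induction n with
  | zero => rw [level_zero]; trivial
  | succ n ih => rw [level_succ]; exact Or.inr ⟨x, ih, hi_of_ge hx⟩

lemma nonempty_interior_solenoid : (interior solenoid).Nonempty := by
  refine ⟨0, mem_interior.2 ⟨{x | (x : ℝ) < 1 / 4}, fun x hx => mem_solenoid_of_le (le_of_lt hx),
    isOpen_lt continuous_subtype_val continuous_const, ?_⟩⟩
  change ((0 : unitInterval) : ℝ) < 1 / 4
  norm_num

/-- The midpoint of the unit interval. -/
noncomputable def half : unitInterval := ⟨1 / 2, by norm_num, by norm_num⟩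

lemma coe_half : (half : ℝ) = 1 / 2 := rfl

lemma half_notMem_solenoid : half ∉ solenoid := fun h => by
  rcases mem_range_of_mem_solenoid h with h | h
  · rw [mem_range_lo, coe_half] at h; norm_num at h
  · rw [mem_range_hi, coe_half] at h; norm_num at h

lemma lo_iterate_mem_solenoid {n : ℕ} {x : unitInterval} :
    lo^[n] x ∈ solenoid ↔ x ∈ solenoid := by
  induction n with
  | zero => rfl
  | succ n ih => rw [Function.iterate_succ_apply', lo_mem_solenoid, ih]

lemma hi_iterate_mem_solenoid {n : ℕ} {x : unitInterval} :
    hi^[n] x ∈ solenoid ↔ x ∈ solenoid := by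
  induction n with
  | zero => rfl
  | succ n ih => rw [Function.iterate_succ_apply', hi_mem_solenoid, ih]

lemma coe_hi_iterate {x : unitInterval} (hx : (x : ℝ) ≤ 3 / 4) (n : ℕ) :
    (hi^[n] x : ℝ) = 3 / 4 - (1 / 4) ^ n * (3 / 4 - x) := by
  induction n with
  | zero => simp
  | succ n ih =>
    have : 0 ≤ (1 / 4 : ℝ) ^ n * (3 / 4 - x) := mul_nonneg (by positivity) (by linarith)
    rw [Function.iterate_succ_apply', coe_hi_of_le (by linarith), ih]
    ring

/-- The points `lo^[n] half` lie outside `solenoid` and decrease to `1/4`, so no interval in it can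
cross `1/4` from the left. -/
lemma le_quarter_of_subset_solenoid {S : Set unitInterval} (hS : S.OrdConnected)
    (hM : S ⊆ solenoid) {a c : unitInterval} (ha : a ∈ S) (hc : c ∈ S) (ha' : (a : ℝ) < 1 / 4) :
    (c : ℝ) ≤ 1 / 4 := by
  by_contra! h
  obtain ⟨n, hn⟩ := exists_quarter_pow_lt (sub_pos.2 h)
  have hpos : (0 : ℝ) < (1 / 4) ^ n := by positivity
  have key := coe_lo_iterate (x := half) (by rw [coe_half]; norm_num) n
  rw [coe_half] at key
  have : lo^[n] half ∈ S := hS.out ha hc ⟨Subtype.coe_le_coe.1 (by rw [key]; linarith),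
    Subtype.coe_le_coe.1 (by rw [key]; linarith)⟩
  exact half_notMem_solenoid (lo_iterate_mem_solenoid.1 (hM this))

lemma three_quarter_le_of_subset_solenoid {S : Set unitInterval} (hS : S.OrdConnected)
    (hM : S ⊆ solenoid) {a c : unitInterval} (ha : a ∈ S) (hc : c ∈ S) (ha' : 3 / 4 < (a : ℝ)) :
    3 / 4 ≤ (c : ℝ) := by
  by_contra! h
  obtain ⟨n, hn⟩ := exists_quarter_pow_lt (sub_pos.2 h)
  have hpos : (0 : ℝ) < (1 / 4) ^ n := by positivity
  have key := coe_hi_iterate (x := half) (by rw [coe_half]; norm_num) n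
  rw [coe_half] at key
  have : hi^[n] half ∈ S := hS.out hc ha ⟨Subtype.coe_le_coe.1 (by rw [key]; linarith),
    Subtype.coe_le_coe.1 (by rw [key]; linarith)⟩
  exact half_notMem_solenoid (hi_iterate_mem_solenoid.1 (hM this))

/-! ### Wandering intervals and the nondegenerate components -/

/-- The interval `[0, 1/4]`. -/
def lowEnd : Set unitInterval := {x | (x : ℝ) ≤ 1 / 4}

/-- The two-sided orbit of wandering intervals. -/
def wandering : ℤ → Set unitInterval
  | Int.ofNat k => f^[k] '' lowEnd
  | Int.negSucc k => unitInterval.symm '' (f^[k] '' lowEnd)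

/-- The reflection exchanges `lo` and `hi` just as `n ↦ -1 - n` exchanges even and odd integers;
this makes the reflected forward orbit a valid backward orbit in `wandering`. -/
lemma symm_lo (x : unitInterval) : unitInterval.symm (lo x) = hi (unitInterval.symm x) := by
  ext
  rw [unitInterval.coe_symm_eq, coe_lo, coe_hi, unitInterval.coe_symm_eq]
  rcases le_total (x : ℝ) (1 / 4) with h | h
  · rw [min_eq_left (by linarith), max_eq_left (by linarith)]
  · rw [min_eq_right (by linarith), max_eq_right (by linarith)]; ring

lemma symm_hi (x : unitInterval) : unitInterval.symm (hi x) = lo (unitInterval.symm x) := by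
  rw [← unitInterval.symm_symm (lo _), symm_lo, unitInterval.symm_symm]

lemma iterate_even_image_lowEnd (k : ℕ) : f^[2 * k] '' lowEnd = lo '' (f^[k] '' lowEnd) := by
  rw [image_image]
  exact image_congr fun x hx => by rw [← f_iterate_lo, lo_of_le hx]

lemma iterate_odd_image_lowEnd (k : ℕ) : f^[2 * k + 1] '' lowEnd = hi '' (f^[k] '' lowEnd) := by
  rw [image_image]
  exact image_congr fun x hx => by rw [← f_iterate_succ_lo, lo_of_le hx]

lemma wandering_two_mul (n : ℤ) : wandering (2 * n) = lo '' wandering n := by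
  rcases n with k | k
  · exact iterate_even_image_lowEnd k
  · rw [show 2 * Int.negSucc k = Int.negSucc (2 * k + 1) by omega]
    simp only [wandering, iterate_odd_image_lowEnd, image_image, symm_hi]

lemma wandering_two_mul_add_one (n : ℤ) : wandering (2 * n + 1) = hi '' wandering n := by
  rcases n with k | k
  · exact iterate_odd_image_lowEnd k
  · rw [show 2 * Int.negSucc k + 1 = Int.negSucc (2 * k) by omega]
    simp only [wandering, iterate_even_image_lowEnd, image_image, symm_lo]

lemma wandering_zero : wandering 0 = lowEnd := image_id _

lemma wandering_neg_one : wandering (-1) = {x : unitInterval | 3 / 4 ≤ (x : ℝ)} := by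
  change unitInterval.symm '' (f^[0] '' lowEnd) = _
  rw [Function.iterate_zero, image_id]
  ext x
  constructor
  · rintro ⟨y, hy, rfl⟩
    change 3 / 4 ≤ 1 - (y : ℝ)
    change (y : ℝ) ≤ 1 / 4 at hy
    linarith
  · intro hx
    refine ⟨unitInterval.symm x, ?_, unitInterval.symm_symm x⟩
    change 1 - (x : ℝ) ≤ 1 / 4
    change 3 / 4 ≤ (x : ℝ) at hx
    linarith

/-- The integers `0 = 2 * 0` and `-1 = 2 * (-1) + 1` are the fixed points of halving; every other
integer gets smaller in absolute value. -/
lemma int_halving_induction {P : ℤ → Prop} (zero : P 0) (neg_one : P (-1))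
    (even : ∀ n, P n → P (2 * n)) (odd : ∀ n, P n → P (2 * n + 1)) (n : ℤ) : P n := by
  induction h : n.natAbs using Nat.strong_induction_on generalizing n with
  | _ N ih =>
    subst h
    by_cases h0 : n = 0
    · exact h0 ▸ zero
    by_cases h1 : n = -1
    · exact h1 ▸ neg_one
    rcases Int.even_or_odd' n with ⟨k, rfl | rfl⟩
    · exact even k (ih _ (by omega) k rfl)
    · exact odd k (ih _ (by omega) k rfl)

lemma image_wandering (n : ℤ) : f '' wandering n = wandering (n + 1) := by
  have even : ∀ n, f '' wandering (2 * n) = wandering (2 * n + 1) := fun n => by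
    rw [wandering_two_mul, wandering_two_mul_add_one, image_image]
    simp only [f_lo]
  induction n using int_halving_induction with
  | zero => exact even 0
  | neg_one =>
    rw [wandering_neg_one, neg_add_cancel, wandering_zero]
    ext y
    constructor
    · rintro ⟨x, hx, rfl⟩
      change (f x : ℝ) ≤ 1 / 4
      change 3 / 4 ≤ (x : ℝ) at hx
      rw [coe_f_of_ge hx]; linarith
    · intro hy
      change (y : ℝ) ≤ 1 / 4 at hy
      have hx : 3 / 4 ≤ (unitInterval.symm y : ℝ) := by
        rw [unitInterval.coe_symm_eq]; linarith
      refine ⟨unitInterval.symm y, hx, ?_⟩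
      ext
      rw [coe_f_of_ge hx, unitInterval.coe_symm_eq]; ring
  | even n _ => exact even n
  | odd n ih =>
    rw [wandering_two_mul_add_one, show 2 * n + 1 + 1 = 2 * (n + 1) by ring, wandering_two_mul,
      ← ih, image_image, image_image]
    simp only [f_hi]

lemma wandering_subset_solenoid (n : ℤ) : wandering n ⊆ solenoid := by
  induction n using int_halving_induction with
  | zero => rw [wandering_zero]; exact fun x => mem_solenoid_of_le
  | neg_one => rw [wandering_neg_one]; exact fun x => mem_solenoid_of_ge
  | even n ih =>
    rw [wandering_two_mul]
    rintro _ ⟨x, hx, rfl⟩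
    exact lo_mem_solenoid.2 (ih hx)
  | odd n ih =>
    rw [wandering_two_mul_add_one]
    rintro _ ⟨x, hx, rfl⟩
    exact hi_mem_solenoid.2 (ih hx)

lemma lowEnd_eq_Iic : lowEnd = Iic base := rfl

lemma isPreconnected_wandering : ∀ n, IsPreconnected (wandering n)
  | Int.ofNat k => by
    rw [wandering, lowEnd_eq_Iic]
    exact ordConnected_Iic.isPreconnected.image _ (f.continuous.iterate k).continuousOn
  | Int.negSucc k => by
    rw [wandering, lowEnd_eq_Iic]
    exact (ordConnected_Iic.isPreconnected.image _ (f.continuous.iterate k).continuousOn).image _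
      unitInterval.continuous_symm.continuousOn

lemma nontrivial_wandering (n : ℤ) : (wandering n).Nontrivial := by
  induction n using int_halving_induction with
  | zero =>
    rw [wandering_zero]
    refine ⟨0, ?_, base, le_refl (base : ℝ), fun h => ?_⟩
    · change ((0 : unitInterval) : ℝ) ≤ 1 / 4
      norm_num
    · have := congrArg Subtype.val h
      rw [coe_base] at this
      norm_num at this
  | neg_one =>
    rw [wandering_neg_one]
    refine ⟨1, ?_, unitInterval.symm base, ?_, fun h => ?_⟩
    · change 3 / 4 ≤ ((1 : unitInterval) : ℝ)
      norm_num
    · change 3 / 4 ≤ 1 - (base : ℝ)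
      rw [coe_base]; norm_num
    · have := congrArg Subtype.val h
      rw [unitInterval.coe_symm_eq, coe_base] at this
      norm_num at this
  | even n ih => rw [wandering_two_mul]; exact ih.image strictMono_lo.injective
  | odd n ih => rw [wandering_two_mul_add_one]; exact ih.image strictMono_hi.injective

lemma disjoint_wandering {m n : ℤ} (h : m ≠ n) : Disjoint (wandering m) (wandering n) := by
  have hlh : ∀ A B : Set unitInterval, Disjoint (lo '' A) (hi '' B) := fun A B => by
    rw [disjoint_left]
    rintro _ ⟨a, -, rfl⟩ ⟨b, -, hb⟩
    exact lo_ne_hi _ _ hb.symm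
  induction hN : m.natAbs + n.natAbs using Nat.strong_induction_on generalizing m n with
  | _ N ih =>
    subst hN
    rcases Int.even_or_odd' m with ⟨p, rfl | rfl⟩ <;> rcases Int.even_or_odd' n with ⟨q, rfl | rfl⟩
    · rw [wandering_two_mul, wandering_two_mul, disjoint_image_iff strictMono_lo.injective]
      exact ih _ (by omega) (by omega) rfl
    · rw [wandering_two_mul, wandering_two_mul_add_one]; exact hlh _ _
    · rw [wandering_two_mul, wandering_two_mul_add_one]; exact (hlh _ _).symm
    · rw [wandering_two_mul_add_one, wandering_two_mul_add_one,
        disjoint_image_iff strictMono_hi.injective]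
      exact ih _ (by omega) (by omega) rfl

lemma injective_wandering : Function.Injective wandering := fun m n h => by
  by_contra hne
  have := disjoint_wandering hne
  rw [h, disjoint_self] at this
  exact (nontrivial_wandering n).nonempty.ne_empty this

/-- If `S` avoids both `[0, 1/4)` and `(3/4, 1]`, it lies in one half, since `half ∉ solenoid`.
Pulling back by `lo` or `hi` then magnifies it by exactly 4; no interval has length above 1. -/
lemma exists_subset_wandering_of_lt (m : ℕ) {S : Set unitInterval} (hS : S.OrdConnected)
    (hM : S ⊆ solenoid) {a b : unitInterval} (ha : a ∈ S) (hb : b ∈ S)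
    (hab : 1 < (4 : ℝ) ^ m * (b - a)) : ∃ n, S ⊆ wandering n := by
  induction m generalizing S a b with
  | zero => linarith [a.2.1, b.2.2]
  | succ m ih =>
    by_cases h0 : ∃ c ∈ S, (c : ℝ) < 1 / 4
    · obtain ⟨c, hc, hc'⟩ := h0
      refine ⟨0, fun x hx => ?_⟩
      rw [wandering_zero]
      exact le_quarter_of_subset_solenoid hS hM hc hx hc'
    by_cases h1 : ∃ c ∈ S, 3 / 4 < (c : ℝ)
    · obtain ⟨c, hc, hc'⟩ := h1
      refine ⟨-1, fun x hx => ?_⟩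
      rw [wandering_neg_one]
      exact three_quarter_le_of_subset_solenoid hS hM hc hx hc'
    push Not at h0 h1
    have hside : S ⊆ range lo ∨ S ⊆ range hi := by
      by_contra! h
      obtain ⟨⟨x, hx, hx'⟩, ⟨y, hy, hy'⟩⟩ := And.imp not_subset.1 not_subset.1 h
      have hx2 := (mem_range_of_mem_solenoid (hM hx)).resolve_left hx'
      have hy2 := (mem_range_of_mem_solenoid (hM hy)).resolve_right hy'
      rw [mem_range_hi] at hx2
      rw [mem_range_lo] at hy2
      exact half_notMem_solenoid (hM (hS.out hy hx ⟨Subtype.coe_le_coe.1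
        (by rw [coe_half]; linarith), Subtype.coe_le_coe.1 (by rw [coe_half]; linarith)⟩))
    rcases hside with hside | hside
    · obtain ⟨a', rfl⟩ := hside ha
      obtain ⟨b', rfl⟩ := hside hb
      have key : ∀ x, lo x ∈ S → (lo x : ℝ) = x / 4 + 3 / 16 := fun x hx => coe_lo_of_ge <| by
        by_contra! h
        have := h0 _ hx
        rw [lo_of_le h.le] at this
        linarith
      obtain ⟨n, hn⟩ := ih (S := lo ⁻¹' S) (hS.preimage_mono strictMono_lo.monotone)
        (fun x hx => lo_mem_solenoid.1 (hM hx)) ha hb (by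
          rw [key _ ha, key _ hb, pow_succ] at hab
          linarith)
      refine ⟨2 * n, ?_⟩
      rw [wandering_two_mul, ← image_preimage_eq_of_subset hside]
      exact image_mono hn
    · obtain ⟨a', rfl⟩ := hside ha
      obtain ⟨b', rfl⟩ := hside hb
      have key : ∀ x, hi x ∈ S → (hi x : ℝ) = x / 4 + 9 / 16 := fun x hx => coe_hi_of_le <| by
        by_contra! h
        have := h1 _ hx
        rw [hi_of_ge h.le] at this
        linarith
      obtain ⟨n, hn⟩ := ih (S := hi ⁻¹' S) (hS.preimage_mono strictMono_hi.monotone)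
        (fun x hx => hi_mem_solenoid.1 (hM hx)) ha hb (by
          rw [key _ ha, key _ hb, pow_succ] at hab
          linarith)
      refine ⟨2 * n + 1, ?_⟩
      rw [wandering_two_mul_add_one, ← image_preimage_eq_of_subset hside]
      exact image_mono hn

lemma exists_subset_wandering {S : Set unitInterval} (hS : IsPreconnected S)
    (hM : S ⊆ solenoid) (hnt : S.Nontrivial) : ∃ n, S ⊆ wandering n := by
  obtain ⟨a, ha, b, hb, hab⟩ := hnt.exists_lt
  have hab' : (0 : ℝ) < b - a := sub_pos.2 hab
  obtain ⟨m, hm⟩ := pow_unbounded_of_one_lt (1 / ((b : ℝ) - a)) (by norm_num : (1 : ℝ) < 4)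
  exact exists_subset_wandering_of_lt m hS.ordConnected hM ha hb (by rwa [← div_lt_iff₀ hab'])

lemma range_wandering : range wandering = nondegenerateComponents solenoid := by
  ext C
  constructor
  · rintro ⟨n, rfl⟩
    obtain ⟨x, hx⟩ := (nontrivial_wandering n).nonempty
    have hxM := wandering_subset_solenoid n hx
    have h1 := (isPreconnected_wandering n).subset_connectedComponentIn hx
      (wandering_subset_solenoid n)
    obtain ⟨m, hm⟩ := exists_subset_wandering isPreconnected_connectedComponentIn
      (connectedComponentIn_subset solenoid x) ((nontrivial_wandering n).mono h1)
    obtain rfl : n = m := by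
      by_contra hne
      exact disjoint_left.1 (disjoint_wandering hne) hx (hm (h1 hx))
    exact ⟨⟨x, hxM, h1.antisymm hm⟩, nontrivial_wandering n⟩
  · rintro ⟨⟨x, hx, rfl⟩, hnt⟩
    obtain ⟨n, hn⟩ := exists_subset_wandering isPreconnected_connectedComponentIn
      (connectedComponentIn_subset solenoid x) hnt
    exact ⟨n, ((isPreconnected_wandering n).subset_connectedComponentIn
      (hn (mem_connectedComponentIn hx)) (wandering_subset_solenoid n)).antisymm hn⟩

/-! ### Zero topological entropy -/

/-- There is a partition into `N` classes of points whose orbits of length `n` are `ε`-close. -/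
def HasColoring (ε : ℝ) (n N : ℕ) : Prop :=
  ∃ c : unitInterval → Fin N, ∀ x y, c x = c y → ∀ t < n, dist (f^[t] x) (f^[t] y) ≤ ε

lemma HasColoring.of_fintype {ε : ℝ} {n : ℕ} {α : Type*} [Fintype α] (c : unitInterval → α)
    (hc : ∀ x y, c x = c y → ∀ t < n, dist (f^[t] x) (f^[t] y) ≤ ε) :
    HasColoring ε n (Fintype.card α) :=
  ⟨fun x => Fintype.equivFin α (c x), fun x y h => hc x y ((Fintype.equivFin α).injective h)⟩

lemma exists_cells {ε : ℝ} (hε : 0 < ε) :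
    ∃ q : ℕ, 0 < q ∧ ∃ g : unitInterval → Fin q, ∀ x y, g x = g y → dist x y ≤ ε := by
  refine ⟨⌊1 / ε⌋₊ + 1, Nat.succ_pos _, fun x => ⟨⌊(x : ℝ) / ε⌋₊, ?_⟩, fun x y h => ?_⟩
  · exact Nat.lt_succ_of_le (Nat.floor_mono (by gcongr; exact x.2.2))
  · have h' : ⌊(x : ℝ) / ε⌋₊ = ⌊(y : ℝ) / ε⌋₊ := congrArg Fin.val h
    have hx1 := Nat.floor_le (div_nonneg x.2.1 hε.le)
    have hx2 := Nat.lt_floor_add_one ((x : ℝ) / ε)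
    have hy1 := Nat.floor_le (div_nonneg y.2.1 hε.le)
    have hy2 := Nat.lt_floor_add_one ((y : ℝ) / ε)
    rw [h'] at hx1 hx2
    rw [le_div_iff₀ hε] at hx1 hy1
    rw [div_lt_iff₀ hε] at hx2 hy2
    rw [dist_eq_abs, abs_le]
    constructor <;> nlinarith

lemma HasColoring.of_cells {ε : ℝ} {q : ℕ} {g : unitInterval → Fin q}
    (hg : ∀ x y, g x = g y → dist x y ≤ ε) (n : ℕ) : HasColoring ε n (q ^ n) := by
  have := HasColoring.of_fintype (ε := ε) (n := n) (fun x (t : Fin n) => g (f^[t] x))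
    fun x y h t ht => hg _ _ (congrFun h ⟨t, ht⟩)
  simpa using this

lemma exists_exit_time (n : ℕ) (x : unitInterval) :
    ∃ s ≤ n, ∃ (b : Bool) (y : unitInterval),
      (∀ t < s, (f^[t] x : ℝ) ∈ Icc (7 / 16 : ℝ) (9 / 16)) ∧
        (s < n → f^[s] x = if b then hi y else lo y) := by
  induction n with
  -- The side and the point are arbitrary here: they are constrained only when the exit occurs
  -- before time `n`.
  | zero => exact ⟨0, le_rfl, true, 0, by simp, by simp⟩
  | succ n ih =>
    obtain ⟨s, hs, b, y, h1, h2⟩ := ih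
    rcases hs.lt_or_eq with hs | rfl
    · exact ⟨s, by omega, b, y, h1, fun _ => h2 hs⟩
    by_cases hlo : f^[s] x ∈ range lo
    · obtain ⟨z, hz⟩ := hlo
      exact ⟨s, by omega, false, z, h1, fun _ => by simp [hz]⟩
    by_cases hhi : f^[s] x ∈ range hi
    · obtain ⟨z, hz⟩ := hhi
      exact ⟨s, by omega, true, z, h1, fun _ => by simp [hz]⟩
    rw [mem_range_lo, not_le] at hlo
    rw [mem_range_hi, not_le] at hhi
    refine ⟨s + 1, le_rfl, b, y, fun t ht => ?_, fun h => absurd h (lt_irrefl _)⟩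
    rcases (Nat.le_of_lt_succ ht).lt_or_eq with h | rfl
    · exact h1 t h
    · exact ⟨hlo.le, hhi.le⟩

/-- Time `t` on a half is time about `t / 2` for the renormalized point. The extra 1 is due to
`f^[2k + 1] ∘ hi = lo ∘ f^[k + 1]`. -/
lemma dist_iterate_le_of_half {ε : ℝ} {n : ℕ} {x y : unitInterval}
    (h : ∀ t < n / 2 + 1, dist (f^[t] x) (f^[t] y) ≤ ε) (b : Bool) {t : ℕ} (ht : t < n) :
    dist (f^[t] (if b then hi x else lo x)) (f^[t] (if b then hi y else lo y)) ≤ ε := by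
  rcases Nat.even_or_odd' t with ⟨k, rfl | rfl⟩ <;> cases b
  · simp only [Bool.false_eq_true, if_false, f_iterate_lo]
    exact (dist_lo_le _ _).trans (h k (by omega))
  · simp only [if_true, f_iterate_hi]
    exact (dist_hi_le _ _).trans (h k (by omega))
  · simp only [Bool.false_eq_true, if_false, f_iterate_succ_lo]
    exact (dist_hi_le _ _).trans (h k (by omega))
  · simp only [if_true, f_iterate_succ_hi]
    exact (dist_lo_le _ _).trans (h (k + 1) (by omega))

/-- A class records the exit time from the gap, the cell of the last point before the exit, the half
entered, and the class of the renormalized point. -/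
lemma HasColoring.of_half {ε : ℝ} {q n N : ℕ} {g : unitInterval → Fin q}
    (hg : ∀ x y, g x = g y → dist x y ≤ ε) (h : HasColoring ε (n / 2 + 1) N) :
    HasColoring ε n ((n + 1) * q * (2 * N)) := by
  obtain ⟨c, hc⟩ := h
  choose S hS B Y hgap hexit using exists_exit_time n
  have := HasColoring.of_fintype (ε := ε) (n := n)
    (fun x => (((⟨S x, Nat.lt_succ_of_le (hS x)⟩, g (f^[S x - 1] x)), (B x, c (Y x))) :
      (Fin (n + 1) × Fin q) × (Bool × Fin N))) ?_
  · simpa using this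
  intro x y hxy t ht
  simp only [Prod.mk.injEq, Fin.mk.injEq] at hxy
  obtain ⟨⟨hSxy, hgxy⟩, hBxy, hcxy⟩ := hxy
  have hgy := hgap y
  have hey := hexit y
  rw [← hSxy] at hgxy hgy hey
  rw [← hBxy] at hey
  rcases lt_or_ge t (S x) with hts | hts
  -- Inside the gap distances only grow, so closeness at time `S x - 1` controls all earlier times.
  · refine le_trans ?_ (hg _ _ hgxy)
    have key := iterate_gap_dist (hgap x) hgy
    rw [key t hts.le, key (S x - 1) (Nat.sub_le _ _)]
    gcongr
    · norm_num
    · omega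
  · obtain ⟨r, rfl⟩ := Nat.exists_eq_add_of_le' hts
    rw [Function.iterate_add_apply, Function.iterate_add_apply, hexit x (by omega),
      hey (by omega)]
    exact dist_iterate_le_of_half (hc _ _ hcxy) _ (by omega)

lemma exists_linear_le_pow (q : ℕ) {r : ℝ} (hr : 1 < r) :
    ∃ p₀ : ℕ, ∀ p ≥ p₀, ((2 * p + 3) * q * 2 : ℝ) ≤ r ^ p := by
  -- For `p ≥ 1` one has `(2p + 3) * q * 2 ≤ 10 * q * p`.
  have h := (tendsto_pow_const_div_const_pow_of_one_lt 1 hr).eventually_lt_const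
    (show (0 : ℝ) < 1 / (10 * q + 1) by positivity)
  obtain ⟨p₀, hp₀⟩ := eventually_atTop.1 h
  refine ⟨max p₀ 1, fun p hp => ?_⟩
  have h1 := hp₀ p ((le_max_left _ _).trans hp)
  have h2 : (1 : ℝ) ≤ p := by exact_mod_cast (le_max_right _ _).trans hp
  rw [pow_one, div_lt_div_iff₀ (by positivity) (by positivity), one_mul] at h1
  have h3 : (0 : ℝ) ≤ q := by positivity
  nlinarith [mul_nonneg h3 (sub_nonneg.2 h2)]

lemma exists_hasColoring_le {ε r : ℝ} (hε : 0 < ε) (hr : 1 < r) :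
    ∃ K : ℝ, ∀ n, ∃ N : ℕ, HasColoring ε n N ∧ (N : ℝ) ≤ K * r ^ n := by
  obtain ⟨q, hq, g, hg⟩ := exists_cells hε
  obtain ⟨p₀, hp₀⟩ := exists_linear_le_pow q hr
  refine ⟨(q : ℝ) ^ (2 * p₀ + 3), fun n => ?_⟩
  have hq' : (1 : ℝ) ≤ q := by exact_mod_cast hq
  induction n using Nat.strong_induction_on with
  | _ n ih =>
    rcases lt_or_ge n (2 * p₀ + 3) with hn | hn
    · refine ⟨q ^ n, HasColoring.of_cells hg n, ?_⟩
      push_cast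
      have h1 : (q : ℝ) ^ n ≤ q ^ (2 * p₀ + 3) := pow_le_pow_right₀ hq' hn.le
      exact h1.trans (le_mul_of_one_le_right (by positivity) (one_le_pow₀ hr.le))
    · obtain ⟨N, hN, hNle⟩ := ih (n / 2 + 1) (by omega)
      refine ⟨_, HasColoring.of_half hg hN, ?_⟩
      -- With `p = n - (n / 2 + 1)`, the exponent gained by halving, `n + 1 ≤ 2p + 3`, so `r ^ p`
      -- absorbs the linear factor.
      have h1 := hp₀ (n - (n / 2 + 1)) (by omega)
      have h2 : ((n + 1 : ℕ) : ℝ) ≤ (2 * (n - (n / 2 + 1) : ℕ) + 3 : ℕ) := by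
        exact_mod_cast (by omega)
      push_cast at h2 ⊢
      have h3 : r ^ n = r ^ (n - (n / 2 + 1)) * r ^ (n / 2 + 1) := by
        rw [← pow_add]; congr 1; omega
      calc ((n : ℝ) + 1) * q * (2 * N)
          = ((n + 1) * q * 2) * N := by ring
        _ ≤ r ^ (n - (n / 2 + 1)) * (q ^ (2 * p₀ + 3) * r ^ (n / 2 + 1)) := by
            refine mul_le_mul (le_trans (by gcongr) h1) hNle (by positivity) (by positivity)
        _ = q ^ (2 * p₀ + 3) * r ^ n := by rw [h3]; ring

open Dynamics in
lemma HasColoring.coverMincard_le {ε : ℝ} {n N : ℕ} (h : HasColoring ε n N) :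
    coverMincard f univ {p : unitInterval × unitInterval | dist p.1 p.2 ≤ ε} n ≤ N := by
  classical
  obtain ⟨c, hc⟩ := h
  have hcov : IsDynCoverOf f univ {p : unitInterval × unitInterval | dist p.1 p.2 ≤ ε} n
      -- One representative of each class forms a dynamical cover.
      (Finset.univ.image (Function.invFun c) : Finset unitInterval) := by
    intro x _
    refine ⟨Function.invFun c (c x), by simp, ?_⟩
    exact mem_dynEntourage.2 fun t ht => hc _ _ (Function.invFun_eq ⟨x, rfl⟩).symm t ht
  refine hcov.coverMincard_le_card.trans ?_
  exact_mod_cast Finset.card_image_le.trans (Finset.card_fin N).le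

open Dynamics in
lemma coverEntropy_eq_zero : coverEntropy (f : unitInterval → unitInterval) univ = 0 := by
  refine le_antisymm ?_ (coverEntropy_nonneg _ univ_nonempty)
  rw [coverEntropy_eq_iSup_basis Metric.uniformity_basis_dist_le]
  refine iSup₂_le fun ε hε => le_of_forall_gt_imp_ge_of_dense fun b hb => ?_
  obtain ⟨a, ha, hab⟩ := EReal.lt_iff_exists_real_btwn.1 hb
  have ha' : 0 < a := by exact_mod_cast ha
  obtain ⟨K, hK⟩ := exists_hasColoring_le hε (Real.one_lt_exp_iff.2 ha')
  refine le_trans ?_ hab.le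
  rw [← EReal.log_exp (a : EReal), ← ExpGrowth.expGrowthSup_pow, EReal.exp_coe]
  refine ExpGrowth.expGrowthSup_le_of_eventually_le (b := ENNReal.ofReal K) ENNReal.ofReal_ne_top
    (Eventually.of_forall fun n => ?_)
  obtain ⟨N, hN, hle⟩ := hK n
  have h1 : ((coverMincard f univ {p : unitInterval × unitInterval | dist p.1 p.2 ≤ ε} n : ℕ∞) :
      ENNReal) ≤ N := by exact_mod_cast ENat.toENNReal_mono hN.coverMincard_le
  refine h1.trans ?_
  rw [← ENNReal.ofReal_pow (Real.exp_pos a).le, ← ENNReal.ofReal_mul' (by positivity),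
    ← ENNReal.ofReal_natCast]
  exact ENNReal.ofReal_le_ofReal hle

end BlownUpOdometer

theorem theorem3 :
    ∃ f : C(unitInterval, unitInterval),
      Function.Surjective f ∧
      -- zero topological entropy
      Dynamics.coverEntropy (f : unitInterval → unitInterval) Set.univ = 0 ∧
      ¬ IntervalDynamics.IsLiYorkeChaotic f ∧
      -- `W` is the one and only infinite limit set
      ∃ W : Set unitInterval,
        (∀ S : Set unitInterval, IntervalDynamics.IsInfiniteOmegaLimitSet f S ↔ S = W) ∧
        -- `M` is the simple set of `W`: associated systems exist, and all of them generate `M`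
        ∃ M : Set unitInterval,
          (∀ M' : Set unitInterval, IntervalDynamics.IsSimpleSet f W M' ↔ M' = M) ∧
          (interior M).Nonempty ∧
          ∃ G : ℤ → Set unitInterval,
            Function.Injective G ∧
            Set.range G = IntervalDynamics.nondegenerateComponents M ∧
            ∀ n : ℤ, f '' G n = G (n + 1) := by
  exact ⟨BlownUpOdometer.f, BlownUpOdometer.surjective_f, BlownUpOdometer.coverEntropy_eq_zero,
    BlownUpOdometer.not_isLiYorkeChaotic, BlownUpOdometer.limitSet,
    BlownUpOdometer.isInfiniteOmegaLimitSet_iff, BlownUpOdometer.solenoid,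
    BlownUpOdometer.isSimpleSet_iff, BlownUpOdometer.nonempty_interior_solenoid,
    BlownUpOdometer.wandering, BlownUpOdometer.injective_wandering,
    BlownUpOdometer.range_wandering, BlownUpOdometer.image_wandering⟩
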